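/- **Setting.** Fix $s>1/2$. Let $\Lambda G^{\mathbb C}$ be the group of (continuous) loops $x:\mathbb S^1\to SL_2(\mathbb C)$ of Sobolev class $H^s$, and write $x=\sum_k x_k\lambda^k$ for the Fourier expansion. Put $\sigma_1=\begin{pmatrix}0&1\\1&0\end{pmatrix}$, $\sigma_3=\begin{pmatrix}1&0\\0&-1\end{pmatrix}$, $\tau(g)=\sigma_3(\bar g^{t})^{-1}\sigma_3$, and $(\tau x)(\lambda)=\tau(x(1/\bar\lambda))$ for loops. Let $\Lambda G$ be the loops in $\Lambda G^{\mathbb C}$ with values in $G=\{g\in SL_2(\mathbb C):\tau(g)=\pm g\}$, and $(\Lambda G^{\mathbb C})_\tau=\{x\in\Lambda G^{\mathbb C}:\tau x=x\}$ (the loops in $SU_{1,1}$). Let $\Lambda^{+}_{\triangle}$ (resp. $\Lambda^-_\triangle$) be the loops in $\Lambda G^{\mathbb C}$ that extend holomorphically to $|\lambda|<1$ (resp. to $|\lambda|>1$ including $\infty$), continuously up to the circle, with upper triangular value at $0$ (resp. lower triangular value at $\infty$). Let $\Lambda^+_{\mathbb R}\subset\Lambda^+_\triangle$ be those whose value at $0$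 has real positive diagonal. The Iwasawa big cell is $$\mathcal B=\{X\in\Lambda G^{\mathbb C}:\ \tau(X)^{-1}X\in\Lambda^-_\triangle\cdot\Lambda^+_\triangle\}.$$ A normalized $SU_{1,1}$-Iwasawa factorization of $X$ is $X=FB$ with $F\in\Lambda G$ and $B\in\Lambda^+_{\mathbb R}$. For $-\infty\le p\le q\le\infty$ let $\Lambda_{p,q}$ be the space of formal Laurent series $\sum_{p\le j\le q}a_j\lambda^j$ with $2\times2$ complex matrix coefficients, and let $P_{p,q}$ be the projection onto it. Put $(\rho W)(\lambda)=\sigma_3\overline{W(1/\bar\lambda)}^{t}\sigma_3$, and for $V=WX$, $V'=\operatorname{adj}(\rho W)X$ (whenever these products converge, for instance for $W\in\Lambda_{-n,n}$ or $W$ an $H^s$ loop) put $$\mathcal L_X(W)=\bigl(P_{-\infty,-1}V,\ \overline{P_{-\infty,-1}V'},\ (V_0-\overline{V'_0})_{11},\ (V_0-\overline{V'_0})_{22},\ (V_0)_{21},\ \overline{(V'_0)_{21}}\bigr),$$ where the bar is complex conjugation on $\mathbb S^1$. **Theorem.** Let $n\ge0$ and $X\in\mathcal B$. (A) Suppose $X\in\Lambda_{-n,\infty}$.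 Then $X$ has a unique normalized factorization $X=FB$, and it is obtained by finite linear algebra: * $\mathcal L_X$ restricts to a complex linear map from $\Lambda_{-n,n}$, of dimension $8n+4$, into $\Lambda_{-2n,-1}\oplus\overline{\Lambda_{-2n,-1}}\oplus\mathbb C^4$, of dimension $16n+4$. * Either $F\in(\Lambda G^{\mathbb C})_\tau$ or $F\in i\sigma_1(\Lambda G^{\mathbb C})_\tau$. In the first case the kernel of $\mathcal L_X$ is $\mathbb C\cdot F^{-1}$, in the second it is $\mathbb C\cdot(F\sigma_3)^{-1}$; this holds both on $\Lambda_{-n,n}$ and on the space of all $H^s$ matrix-valued loops. * If $0\ne W\in\Lambda_{-n,n}$ and $\mathcal L_X(W)=0$, then $\det W$ is a nonzero constant $d$, and for every $c\in\mathbb C$ with $c^2d=1$ there is $k\in\{0,1,2,3\}$ with $F=((i\sigma_3)^k\,cW)^{-1}$. * For $W\in\Lambda_{-n,n}$, the conditions "$W^{-1}\in\Lambda G$ and $WX\in\Lambda^+_{\mathbb R}$" are equivalent to the following finite algebraic system on the coefficients of $W$, which involves only the coefficients $X_{-n},\dots,X_n$ of $X$: $\det W=1$; $\rho W=\operatorname{adj}W$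 or $\rho W=-\operatorname{adj}W$; $P_{-2n,-1}(WX)=0$; and $(WX)_0$ is upper triangular with real positive diagonal. This system has exactly one solution $W\in\Lambda_{-n,n}$, namely $W=F^{-1}$. (B) Let $X=FB$ be a normalized factorization, $X$ not being assumed to lie in $\Lambda_{-n,\infty}$. Then $F\in\Lambda_{-n,n}$ if and only if $X$ extends meromorphically to the unit disk (continuously up to the circle) with no pole outside $\lambda=0$ and a pole of order at most $n$ at $\lambda=0$. Moreover $n$ is the smallest integer $m\ge0$ with $F\in\Lambda_{-m,m}$ if and only if $X$ has such an extension whose pole at $0$ has order exactly $n$. -/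

import Mathlib

noncomputable section

open Complex Matrix Metric

namespace LoopIwasawa

/-- Complex `2 × 2` matrices. -/
abbrev M2 : Type := Matrix (Fin 2) (Fin 2) ℂ

/-- Matrix-valued functions on the unit circle, with pointwise operations. -/
abbrev Loop : Type := Circle → M2

def sigma1 : M2 := !![0, 1; 1, 0]

def sigma3 : M2 := !![1, 0; 0, -1]

/-! ### Fourier coefficients and Sobolev loops -/

/-- The Fourier coefficients `a_k` of `x = ∑ a_k λ^k`, taken entrywise. -/
def coeff (x : Loop) (k : ℤ) : M2 :=
  Matrix.of fun i j => fourierCoeff (fun t : UnitAddCircle => x (AddCircle.toCircle t) i j) k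

/-- Loops of Sobolev class `H^s`. It is used for `s > 1/2`, where every class in `H^s` has a
unique continuous representative, which is the one taken here. -/
def IsHs (s : ℝ) (x : Loop) : Prop :=
  Continuous x ∧
    ∀ i j, Summable fun k : ℤ => (1 + (k : ℝ) ^ 2) ^ s * ‖coeff x k i j‖ ^ 2

/-- The loop group `Λ SL₂(ℂ)` of `H^s` loops. -/
def LambdaGC (s : ℝ) : Set Loop := {x | IsHs s x ∧ ∀ z, (x z).det = 1}

/-! ### The real form -/

/-- `τ(g) = σ₃ (ḡᵗ)⁻¹ σ₃`. -/
def tau (g : M2) : M2 := sigma3 * (gᴴ)⁻¹ * sigma3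

/-- The extension of `τ` to loops, `(τ x)(λ) = τ (x (1 / λ̄))`; on the circle `1 / λ̄ = λ`. -/
def loopTau (x : Loop) : Loop := fun z => tau (x z)

/-- `G = {g ∈ SL₂(ℂ) | τ(g) = ± g}`. -/
def G : Set M2 := {g | g.det = 1 ∧ (tau g = g ∨ tau g = -g)}

/-- Loops with values in `G`. -/
def LambdaG (s : ℝ) : Set Loop := {x | x ∈ LambdaGC s ∧ ∀ z, x z ∈ G}

/-- The fixed-point subgroup of `τ`, that is, the loops in `SU_{1,1}`. -/
def LambdaGTau (s : ℝ) : Set Loop := {x | x ∈ LambdaGC s ∧ loopTau x = x}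

/-- The coset `iσ₁ · (ΛG^ℂ)_τ`. -/
def sigma1LambdaGTau (s : ℝ) : Set Loop :=
  {x | ∃ y ∈ LambdaGTau s, x = fun z => (I • sigma1) * y z}

/-! ### Loops extending to the disks, and the big cells -/

/-- `f` is a holomorphic extension to the open unit disk (continuous up to the boundary) of `x`. -/
def IsPlusExtension (x : Loop) (f : ℂ → M2) : Prop :=
  (∀ i j, DiffContOnCl ℂ (fun z => f z i j) (ball 0 1)) ∧ ∀ z : Circle, f z = x z

/-- `λ ↦ f (1 / λ)` is a holomorphic extension of `x` to `{|λ| > 1} ∪ {∞}`; its value at `∞`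
is `f 0`. -/
def IsMinusExtension (x : Loop) (f : ℂ → M2) : Prop :=
  (∀ i j, DiffContOnCl ℂ (fun z => f z i j) (ball 0 1)) ∧ ∀ z : Circle, f ((z : ℂ)⁻¹) = x z

/-- Loops in `Λ⁺` whose value at `0` is upper triangular. -/
def LambdaPlusTri (s : ℝ) : Set Loop :=
  {x | x ∈ LambdaGC s ∧ ∃ f, IsPlusExtension x f ∧ f 0 1 0 = 0}

/-- Loops in `Λ⁻` whose value at `∞` is lower triangular. -/
def LambdaMinusTri (s : ℝ) : Set Loop :=
  {x | x ∈ LambdaGC s ∧ ∃ f, IsMinusExtension x f ∧ f 0 0 1 = 0}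

/-- Upper triangular matrices with real positive diagonal. -/
def TriReal : Set M2 :=
  {b | b 1 0 = 0 ∧ (0 < (b 0 0).re ∧ (b 0 0).im = 0) ∧ (0 < (b 1 1).re ∧ (b 1 1).im = 0)}

/-- Loops in `Λ⁺` whose value at `0` is upper triangular with real positive diagonal. -/
def LambdaPlusReal (s : ℝ) : Set Loop :=
  {x | x ∈ LambdaGC s ∧ ∃ f, IsPlusExtension x f ∧ f 0 ∈ TriReal}

/-- The Birkhoff big cell: the loops `B₋ B₊` with trivial middle term. -/
def birkhoffBigCell (s : ℝ) : Set Loop :=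
  {x | ∃ b ∈ LambdaMinusTri s, ∃ c ∈ LambdaPlusTri s, x = b * c}

/-- The Iwasawa big cell. -/
def iwasawaBigCell (s : ℝ) : Set Loop :=
  {x | x ∈ LambdaGC s ∧ (loopTau x)⁻¹ * x ∈ birkhoffBigCell s}

/-- `X = F B` is the normalized `SU_{1,1}`-Iwasawa factorization of `X`. -/
def IsNormalizedIwasawa (s : ℝ) (X F B : Loop) : Prop :=
  F ∈ LambdaG s ∧ B ∈ LambdaPlusReal s ∧ X = F * B

/-! ### Formal Laurent series -/

/-- Formal Laurent series `∑ a_j λ^j` with `p ≤ j ≤ q`, as coefficient sequences. -/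
def Lam (p : WithBot ℤ) (q : WithTop ℤ) : Submodule ℂ (ℤ → M2) where
  carrier := {a | ∀ j : ℤ, ¬ (p ≤ (j : WithBot ℤ) ∧ (j : WithTop ℤ) ≤ q) → a j = 0}
  zero_mem' := fun _ _ => rfl
  add_mem' := fun {a b} ha hb j hj => by simp [ha j hj, hb j hj]
  smul_mem' := fun c a ha j hj => by simp [ha j hj]

/-- `Λ_{-n,n}`. -/
abbrev LamSym (n : ℕ) : Submodule ℂ (ℤ → M2) :=
  Lam ((-(n : ℤ) : ℤ) : WithBot ℤ) (((n : ℤ) : ℤ) : WithTop ℤ)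

/-- `Λ_{-n,∞}`. -/
abbrev LamGE (n : ℕ) : Submodule ℂ (ℤ → M2) :=
  Lam ((-(n : ℤ) : ℤ) : WithBot ℤ) ⊤

open Classical in
/-- The projection `P_{p,q}`. -/
def proj (p : WithBot ℤ) (q : WithTop ℤ) (a : ℤ → M2) : ℤ → M2 :=
  fun j => if p ≤ (j : WithBot ℤ) ∧ (j : WithTop ℤ) ≤ q then a j else 0

/-- Product of Laurent series. -/
def conv (a b : ℤ → M2) : ℤ → M2 := fun k => ∑' j : ℤ, a j * b (k - j)

/-- `(ρ W)(λ) = σ₃ (W (1 / λ̄))ᴴ σ₃` on coefficients. -/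
def rho (a : ℤ → M2) : ℤ → M2 := fun k => sigma3 * (a (-k))ᴴ * sigma3

/-- The adjugate (for `2 × 2` matrices it is linear, so it acts on coefficients). -/
def adj (a : ℤ → M2) : ℤ → M2 := fun k => (a k).adjugate

/-- Entrywise complex conjugation on the unit circle, `∑ a_j λ^j ↦ ∑ ā_j λ^{-j}`. -/
def bar (a : ℤ → M2) : ℤ → M2 := fun k => (a (-k)).map star

/-- The value `𝓛_X(W)`, in terms of the coefficients of `X` and `W`. -/
def iwasawaMap (X W : ℤ → M2) : (ℤ → M2) × (ℤ → M2) × (Fin 4 → ℂ) :=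
  (proj ⊥ ((-1 : ℤ) : WithTop ℤ) (conv W X),
    bar (proj ⊥ ((-1 : ℤ) : WithTop ℤ) (conv (adj (rho W)) X)),
    ![(conv W X 0 - (conv (adj (rho W)) X 0).map star) 0 0,
      (conv W X 0 - (conv (adj (rho W)) X 0).map star) 1 1,
      conv W X 0 1 0,
      ((conv (adj (rho W)) X 0).map star) 1 0])

/-! Linearity of `𝓛_X` on `Λ_{-n,n}`. -/

theorem conv_eq_sum {n : ℕ} {a : ℤ → M2} (ha : a ∈ LamSym n) (b : ℤ → M2) (k : ℤ) :
    conv a b k = ∑ j ∈ Finset.Icc (-(n : ℤ)) n, a j * b (k - j) := by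
  unfold conv
  refine tsum_eq_sum fun j hj => ?_
  have h0 : a j = 0 := by
    refine ha j fun h => hj ?_
    rw [Finset.mem_Icc]
    exact ⟨WithBot.coe_le_coe.1 h.1, WithTop.coe_le_coe.1 h.2⟩
  rw [h0, zero_mul]

theorem adj_rho_mem {n : ℕ} {a : ℤ → M2} (ha : a ∈ LamSym n) : adj (rho a) ∈ LamSym n := by
  intro j hj
  have h0 : a (-j) = 0 := by
    refine ha _ fun h => hj ⟨?_, ?_⟩
    · have := WithTop.coe_le_coe.1 h.2
      exact WithBot.coe_le_coe.2 (by omega)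
    · have := WithBot.coe_le_coe.1 h.1
      exact WithTop.coe_le_coe.2 (by omega)
  simp [adj, rho, h0]

theorem adj_rho_apply (a : ℤ → M2) (k : ℤ) :
    adj (rho a) k = !![star (a (-k) 1 1), star (a (-k) 1 0);
      star (a (-k) 0 1), star (a (-k) 0 0)] := by
  have h : rho a k = !![star (a (-k) 0 0), -star (a (-k) 1 0);
      -star (a (-k) 0 1), star (a (-k) 1 1)] := by
    unfold rho
    rw [Matrix.eta_fin_two ((a (-k))ᴴ), sigma3]
    simp [Matrix.conjTranspose_apply]
  rw [adj, h, Matrix.adjugate_fin_two_of]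
  simp

theorem adj_rho_add (a b : ℤ → M2) : adj (rho (a + b)) = adj (rho a) + adj (rho b) := by
  funext k
  rw [Pi.add_apply, adj_rho_apply, adj_rho_apply, adj_rho_apply]
  simp

theorem adj_rho_smul (c : ℂ) (a : ℤ → M2) :
    adj (rho (c • a)) = (starRingEnd ℂ c) • adj (rho a) := by
  funext k
  rw [Pi.smul_apply, adj_rho_apply, adj_rho_apply]
  simp

theorem proj_add (p : WithBot ℤ) (q : WithTop ℤ) (a b : ℤ → M2) :
    proj p q (a + b) = proj p q a + proj p q b := by
  funext k
  simp only [proj, Pi.add_apply]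
  split_ifs <;> simp

theorem proj_smul (p : WithBot ℤ) (q : WithTop ℤ) (c : ℂ) (a : ℤ → M2) :
    proj p q (c • a) = c • proj p q a := by
  funext k
  simp only [proj, Pi.smul_apply]
  split_ifs <;> simp

theorem bar_add (a b : ℤ → M2) : bar (a + b) = bar a + bar b := by
  funext k
  ext i j
  simp [bar]

theorem bar_smul (c : ℂ) (a : ℤ → M2) : bar (starRingEnd ℂ c • a) = c • bar a := by
  funext k
  ext i j
  simp [bar]

theorem conv_add {n : ℕ} {a b : ℤ → M2} (ha : a ∈ LamSym n) (hb : b ∈ LamSym n) (x : ℤ → M2) :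
    conv (a + b) x = conv a x + conv b x := by
  funext k
  rw [Pi.add_apply, conv_eq_sum ((LamSym n).add_mem ha hb), conv_eq_sum ha, conv_eq_sum hb,
    ← Finset.sum_add_distrib]
  simp [add_mul]

theorem conv_smul {n : ℕ} (c : ℂ) {a : ℤ → M2} (ha : a ∈ LamSym n) (x : ℤ → M2) :
    conv (c • a) x = c • conv a x := by
  funext k
  rw [Pi.smul_apply, conv_eq_sum ((LamSym n).smul_mem c ha), conv_eq_sum ha, Finset.smul_sum]
  simp

/-- The restriction of `𝓛_X` to `Λ_{-n,n}`, as a complex linear map. -/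
def iwasawaLin (n : ℕ) (X : ℤ → M2) :
    LamSym n →ₗ[ℂ] (ℤ → M2) × (ℤ → M2) × (Fin 4 → ℂ) where
  toFun W := iwasawaMap X W
  map_add' a b := by
    have h1 := conv_add a.2 b.2 X
    have h2 := conv_add (adj_rho_mem a.2) (adj_rho_mem b.2) X
    simp only [iwasawaMap, Submodule.coe_add, adj_rho_add, h1, h2, proj_add, bar_add]
    refine Prod.ext rfl (Prod.ext rfl ?_)
    funext k
    fin_cases k <;> simp <;> ring
  map_smul' c a := by
    have h1 := conv_smul c a.2 X
    have h2 := conv_smul (starRingEnd ℂ c) (adj_rho_mem a.2) X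
    simp only [iwasawaMap, Submodule.coe_smul, adj_rho_smul, h1, h2, proj_smul, bar_smul]
    refine Prod.ext rfl (Prod.ext rfl ?_)
    funext k
    fin_cases k <;> simp <;> ring

/-- The target space `Λ_{-2n,-1} ⊕ \overline{Λ_{-2n,-1}} ⊕ ℂ⁴`. -/
def targetSpace (n : ℕ) : Submodule ℂ ((ℤ → M2) × (ℤ → M2) × (Fin 4 → ℂ)) :=
  (Lam ((-(2 * n : ℤ) : ℤ) : WithBot ℤ) ((-1 : ℤ) : WithTop ℤ)).prod
    ((Lam ((1 : ℤ) : WithBot ℤ) ((2 * n : ℤ) : WithTop ℤ)).prod ⊤)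

/-- The loop `∑_{|j| ≤ n} a_j λ^j`. -/
def laurentLoop (n : ℕ) (a : ℤ → M2) : Loop :=
  fun z => ∑ j ∈ Finset.Icc (-(n : ℤ)) n, (z : ℂ) ^ j • a j

/-! ### Meromorphic extension -/

/-- `f` is a meromorphic extension of `x` to the unit disk, holomorphic away from `0` and
continuous up to the boundary. -/
def IsMeromorphicExtension (x : Loop) (f : ℂ → M2) : Prop :=
  (∀ i j, ContinuousOn (fun z => f z i j) (closedBall 0 1 \ {0}) ∧
    DifferentiableOn ℂ (fun z => f z i j) (ball 0 1 \ {0}) ∧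
    MeromorphicAt (fun z => f z i j) 0) ∧ ∀ z : Circle, f z = x z

/-- `x` extends meromorphically to the unit disk, without poles outside `0` and with a pole of
order at most `n` at `0`. -/
def ExtendsWithPoleLE (x : Loop) (n : ℕ) : Prop :=
  ∃ f, IsMeromorphicExtension x f ∧
    ∀ i j, ((-(n : ℤ) : ℤ) : WithTop ℤ) ≤ meromorphicOrderAt (fun z => f z i j) 0

/-- `x` extends meromorphically to the unit disk, without poles outside `0` and with a pole of
order exactly `n` at `0` (for `n = 0`: the extension is holomorphic and not zero at `0`). -/
def ExtendsWithPole (x : Loop) (n : ℕ) : Prop :=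
  ∃ f, IsMeromorphicExtension x f ∧
    (∀ i j, ((-(n : ℤ) : ℤ) : WithTop ℤ) ≤ meromorphicOrderAt (fun z => f z i j) 0) ∧
    ∃ i j, meromorphicOrderAt (fun z => f z i j) 0 = ((-(n : ℤ) : ℤ) : WithTop ℤ)

/-! ### The algebraic system -/

/-- A finite system of polynomial conditions (over `ℝ`) on the real and imaginary parts of the
coefficients `W_j`, `|j| ≤ n`, involving only the coefficients `X_j`, `|j| ≤ n`:
`det W = 1`; `ρ W = ± adj W`; `P_{-2n,-1}(W X) = 0`; and the constant coefficient of `W X` is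
upper triangular with real positive diagonal. -/
def AlgebraicSystem (n : ℕ) (X W : ℤ → M2) : Prop :=
  (∀ m ∈ Finset.Icc (-(2 * n : ℤ)) (2 * n),
    ∑ j ∈ Finset.Icc (-(n : ℤ)) n, (W j 0 0 * W (m - j) 1 1 - W j 0 1 * W (m - j) 1 0)
      = if m = 0 then 1 else 0) ∧
  ((∀ j ∈ Finset.Icc (-(n : ℤ)) n, sigma3 * (W (-j))ᴴ * sigma3 = (W j).adjugate) ∨
    (∀ j ∈ Finset.Icc (-(n : ℤ)) n, sigma3 * (W (-j))ᴴ * sigma3 = -(W j).adjugate)) ∧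
  (∀ k ∈ Finset.Icc (-(2 * n : ℤ)) (-1),
    ∑ j ∈ Finset.Icc (-(n : ℤ)) n, W j * X (k - j) = 0) ∧
  ∑ j ∈ Finset.Icc (-(n : ℤ)) n, W j * X (-j) ∈ TriReal

end LoopIwasawa

end

/-! For `s > 1/2`, `H^s` is an algebra of absolutely convergent Fourier series (`MemHs.summable`,
`MemHs.mul`). Products of loops are therefore convolutions of coefficients, and extending to a disk
means that the coefficients of one sign vanish. Two further facts drive the proof. A loop without
negative and without positive coefficients is constant (`eq_const_of_plus_of_minus`). The involution
ρ is antimultiplicative and reverses degrees, and F ∈ ΛG means ρF = εF⁻¹ with one sign ε = ±1 on the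
whole circle (`mem_lambdaG_iff`).

Existence and uniqueness: if ρ(X)X = bc, then ρ-invariance makes ρ(b)c⁻¹ = ρ(c)⁻¹b a constant
diagonal matrix D, so ρ(X)X = ρ(c)Dc. A diagonal T with ρ(T)T = εD gives B = Tc and F = XB⁻¹. Two
factorizations differ by a loop that is both plus and minus, and positivity of the diagonal forces
it to be 1.

Degree (`coeff_mem_lamSym_iff`): F = XB⁻¹ starts no lower than X does, and ρF = εF⁻¹ reflects this
bound to the positive side.

Kernel (`iwasawaMap_coeff_eq_zero_iff`): put θ(W) = adj ρW, so that θ(F) = εF, and let U = WF. Then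
WX = UB and θ(W)X = εθ(U)B. The two projections say that U and θ(U) are plus, so U is constant; the
four scalar equations then force U = diag(c, εc). Hence W is a multiple of F⁻¹ or of σ₃F⁻¹ =
(Fσ₃)⁻¹, and the determinant fixes the scalar up to sign.

The algebraic system is the definition of a normalized factorization (W⁻¹, WX) read off
coefficientwise, so its unique solvability is that of the factorization. Part (B) combines the
degree statement with the fact that the pole order at 0 is read off the lowest Fourier coefficient
of X. -/

noncomputable section

open Complex Matrix Metric

namespace LoopIwasawa

section FourierSeries

open MeasureTheory AddCircle

/-! ### Scalar Fourier series on the circle -/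

/-- Fourier coefficients of a function on the unit circle. -/
def fc (f : Circle → ℂ) (k : ℤ) : ℂ :=
  fourierCoeff (fun t : UnitAddCircle => f (AddCircle.toCircle t)) k

theorem coeff_apply (x : Loop) (k : ℤ) (i j : Fin 2) :
    coeff x k i j = fc (fun z => x z i j) k := rfl

theorem toCircle_surjective (z : Circle) : ∃ t : UnitAddCircle, AddCircle.toCircle t = z := by
  obtain ⟨t, ht⟩ := (AddCircle.homeomorphCircle (T := (1 : ℝ)) one_ne_zero).surjective z
  exact ⟨t, by simpa [AddCircle.homeomorphCircle_apply] using ht⟩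

theorem fourier_eq_toCircle_zpow (k : ℤ) (t : UnitAddCircle) :
    fourier k t = ((AddCircle.toCircle t : Circle) : ℂ) ^ k := by
  rw [fourier_apply, AddCircle.toCircle_zsmul, Circle.coe_zpow]

theorem norm_circle_zpow (z : Circle) (k : ℤ) : ‖(z : ℂ) ^ k‖ = 1 := by
  rw [norm_zpow, Circle.norm_coe, _root_.one_zpow]

theorem continuous_circle_zpow (k : ℤ) : Continuous fun z : Circle => (z : ℂ) ^ k := by
  simp only [← Circle.coe_zpow]
  exact continuous_subtype_val.comp (continuous_zpow k)

theorem hasSum_fc {f : Circle → ℂ} (hf : Continuous f) (hs : Summable fun k => ‖fc f k‖)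
    (z : Circle) : HasSum (fun k : ℤ => fc f k * (z : ℂ) ^ k) (f z) := by
  obtain ⟨t, rfl⟩ := toCircle_surjective z
  have hc : Continuous fun t : UnitAddCircle => f (AddCircle.toCircle t) :=
    hf.comp AddCircle.continuous_toCircle
  have := has_pointwise_sum_fourier_series_of_summable (T := 1)
    (f := ⟨fun t : UnitAddCircle => f (AddCircle.toCircle t), hc⟩) hs.of_norm t
  simp only [fourier_eq_toCircle_zpow] at this
  exact this

theorem fc_ext {f g : Circle → ℂ} (hf : Continuous f) (hg : Continuous g)
    (hs : Summable fun k => ‖fc f k‖) (h : ∀ k, fc f k = fc g k) : f = g := by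
  funext z
  refine (hasSum_fc hf hs z).unique ?_
  simp only [h] at hs ⊢
  exact hasSum_fc hg hs z

/-- The Fourier coefficients of a product, one factor of which is given by an absolutely
convergent Fourier series. -/
theorem hasSum_fc_mul {f g : Circle → ℂ} {a : ℤ → ℂ} (ha : Summable fun k => ‖a k‖)
    (hf : ∀ z : Circle, HasSum (fun k : ℤ => a k * (z : ℂ) ^ k) (f z)) (hg : Continuous g)
    (k : ℤ) : HasSum (fun j => a j * fc g (k - j)) (fc (fun z => f z * g z) k) := by
  obtain ⟨M, hM⟩ : ∃ M, ∀ z : Circle, ‖g z‖ ≤ M := by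
    obtain ⟨M, hM⟩ := (isCompact_range hg.norm).bddAbove
    exact ⟨M, fun z => hM ⟨z, rfl⟩⟩
  have hgc : Continuous fun t : UnitAddCircle => g (AddCircle.toCircle t) :=
    hg.comp AddCircle.continuous_toCircle
  -- Term-by-term integration of the series of f against λ^{-k} g: the j-th term is dominated by the
  -- constant |a_j| · sup |g|, and its integral is a_j times the coefficient of g of index k - j.
  have key := hasSum_integral_of_dominated_convergence (μ := (haarAddCircle : Measure UnitAddCircle))
    (F := fun (j : ℤ) (t : UnitAddCircle) =>
      a j * (fourier (-(k - j)) t • g (AddCircle.toCircle t)))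
    (f := fun t => fourier (-k) t • (f (AddCircle.toCircle t) * g (AddCircle.toCircle t)))
    (fun j _ => ‖a j‖ * M)
    (fun j => (continuous_const.mul
      (((fourier (-(k - j))).continuous).smul hgc)).aestronglyMeasurable)
    (fun j => Filter.Eventually.of_forall fun t => by
      rw [norm_mul, norm_smul, fourier_eq_toCircle_zpow, norm_circle_zpow, one_mul]
      exact mul_le_mul_of_nonneg_left (hM _) (norm_nonneg _))
    (Filter.Eventually.of_forall fun t => ha.mul_right M)
    (integrable_const _)
    (Filter.Eventually.of_forall fun t => by
      have h1 := ((hf (AddCircle.toCircle t)).mul_right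
        (fourier (-k) t * g (AddCircle.toCircle t)))
      rw [smul_eq_mul, mul_left_comm]
      refine h1.congr_fun fun j => ?_
      have : fourier (-(k - j)) t = fourier (-k) t * ((AddCircle.toCircle t : Circle) : ℂ) ^ j := by
        rw [← fourier_eq_toCircle_zpow, ← fourier_add, neg_sub, sub_eq_neg_add]
      rw [this, smul_eq_mul, mul_comm (fourier (-k) t), mul_assoc, mul_assoc])
  simp only [integral_const_mul] at key
  exact key

theorem fc_one (k : ℤ) : fc (fun _ => 1) k = if k = 0 then 1 else 0 := by
  have h := fourierCoeff_fourier (T := 1) 0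
  have h2 : (fun _ : UnitAddCircle => (1 : ℂ)) = fourier 0 := by
    funext t; rw [fourier_zero]
  unfold fc
  rw [h2, h, Pi.single_apply]

/-- Multiplication by the constant function 1 in `hasSum_fc_mul` leaves only the term j = k. -/
theorem fc_of_hasSum {f : Circle → ℂ} {a : ℤ → ℂ} (ha : Summable fun k => ‖a k‖)
    (hf : ∀ z : Circle, HasSum (fun k : ℤ => a k * (z : ℂ) ^ k) (f z)) : fc f = a := by
  funext k
  have h := hasSum_fc_mul ha hf (g := fun _ => 1) continuous_const k
  simp only [mul_one] at h
  refine h.unique ?_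
  have : ∀ j, a j * fc (fun _ => 1) (k - j) = if j = k then a k else 0 := by
    intro j
    rw [fc_one]
    by_cases hj : j = k
    · simp [hj]
    · rw [if_neg (by omega), if_neg hj, mul_zero]
  simp only [this]
  exact hasSum_ite_eq k (a k)

/-! ### The Sobolev algebra -/

/-- Functions on the circle of Sobolev class `H^s`. -/
def MemHs (s : ℝ) (f : Circle → ℂ) : Prop :=
  Continuous f ∧ Summable fun k : ℤ => (1 + (k : ℝ) ^ 2) ^ s * ‖fc f k‖ ^ 2

/-- Comparison with |k|^{-2s}; this is where s > 1/2 is needed. -/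
theorem summable_sobolev_weight {s : ℝ} (hs : 1 / 2 < s) :
    Summable fun k : ℤ => ((1 + (k : ℝ) ^ 2) ^ s)⁻¹ := by
  have h1 : Summable fun k : ℤ => |(k : ℝ)| ^ (-(2 * s)) :=
    Real.summable_abs_int_rpow (by linarith)
  -- The bound fails at k = 0, where the real power of 0 is 0 while the weight is 1, so it is used
  -- only off one index.
  refine Summable.of_norm_bounded_eventually h1 ?_
  have : ({0}ᶜ : Set ℤ) ∈ Filter.cofinite := (Set.finite_singleton 0).compl_mem_cofinite
  filter_upwards [this] with k hk
  have hk0 : (0 : ℝ) < |(k : ℝ)| := abs_pos.2 (by exact_mod_cast hk)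
  rw [Real.norm_of_nonneg (by positivity), Real.rpow_neg hk0.le, Real.rpow_mul hk0.le]
  refine inv_anti₀ (by positivity) (Real.rpow_le_rpow (by positivity) ?_ (by linarith))
  rw [Real.rpow_two, sq_abs]
  linarith

/-- The inequality a ≤ w a² + w⁻¹ replaces Cauchy–Schwarz: both terms on the right are summable. -/
theorem MemHs.summable {s : ℝ} (hs : 1 / 2 < s) {f : Circle → ℂ} (hf : MemHs s f) :
    Summable fun k => ‖fc f k‖ := by
  refine Summable.of_nonneg_of_le (fun k => norm_nonneg _) (fun k => ?_)
    (hf.2.add (summable_sobolev_weight hs))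
  have hw : 0 < (1 + (k : ℝ) ^ 2) ^ s := Real.rpow_pos_of_pos (by positivity) s
  set w := (1 + (k : ℝ) ^ 2) ^ s
  set a := ‖fc f k‖
  have h1 : w * a ^ 2 + w⁻¹ - a = w⁻¹ * ((w * a - 1 / 2) ^ 2 + 3 / 4) := by
    field_simp; ring
  have : 0 ≤ w⁻¹ * ((w * a - 1 / 2) ^ 2 + 3 / 4) := by positivity
  linarith

/-- Jensen's inequality for the weights `β`. -/
theorem sq_le_of_hasSum {β γ : ℤ → ℝ} (hβ0 : ∀ k, 0 ≤ β k) (hβ : Summable β) {t S : ℝ}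
    (ht : HasSum (fun j => β j * γ j) t) (hS : HasSum (fun j => β j * γ j ^ 2) S) :
    t ^ 2 ≤ (∑' j, β j + 1) * S := by
  obtain ⟨b, hb⟩ := hβ
  rw [hb.tsum_eq]
  have hb0 : 0 ≤ b := hb.nonneg hβ0
  -- Expanding ∑ β (γ - m)² ≥ 0 with m close to the weighted mean gives the claim. Dividing by b + 1
  -- instead of b keeps the case β = 0 harmless.
  obtain ⟨m, rfl⟩ : ∃ m, t = m * (b + 1) := ⟨t / (b + 1), by field_simp⟩
  have h1 := (hS.sub (ht.mul_left (2 * m))).add (hb.mul_left (m ^ 2))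
  have h2 := h1.nonneg fun j => by
    have : β j * γ j ^ 2 - 2 * m * (β j * γ j) + m ^ 2 * β j = β j * (γ j - m) ^ 2 := by ring
    rw [this]
    exact mul_nonneg (hβ0 j) (sq_nonneg _)
  have h4 : m ^ 2 * (b + 1) ≤ S := by nlinarith [sq_nonneg m]
  calc (m * (b + 1)) ^ 2 = (b + 1) * (m ^ 2 * (b + 1)) := by ring
    _ ≤ (b + 1) * S := mul_le_mul_of_nonneg_left h4 (by linarith)

/-- Young's inequality `ℓ¹ * ℓ² ⊆ ℓ²`. -/
theorem summable_sq_conv {β α : ℤ → ℝ} (hβ0 : ∀ k, 0 ≤ β k) (hβ : Summable β)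
    (hα0 : ∀ k, 0 ≤ α k) (hα : Summable fun k => α k ^ 2) :
    (∀ k, Summable fun j => β j * α (k - j)) ∧
      Summable fun k => (∑' j, β j * α (k - j)) ^ 2 := by
  have hprod : Summable fun p : ℤ × ℤ => β p.1 * α p.2 ^ 2 :=
    Summable.mul_of_nonneg (f := β) (g := fun k => α k ^ 2) hβ hα hβ0 fun k => sq_nonneg (α k)
  -- The shear (k, j) ↦ (j, k - j) turns the product family into the convolution family.
  let e : ℤ × ℤ ≃ ℤ × ℤ :=
    { toFun := fun p => (p.2, p.1 - p.2)
      invFun := fun p => (p.1 + p.2, p.1)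
      left_inv := fun p => by ext <;> simp
      right_inv := fun p => by ext <;> simp }
  have hprod' : Summable fun p : ℤ × ℤ => β p.2 * α (p.1 - p.2) ^ 2 := by
    have h := hprod.comp_injective e.injective
    exact h
  have hS : ∀ k, Summable fun j => β j * α (k - j) ^ 2 := fun k =>
    Summable.prod_factor (f := fun p : ℤ × ℤ => β p.2 * α (p.1 - p.2) ^ 2) hprod' k
  have hT : ∀ k, Summable fun j => β j * α (k - j) := by
    intro k
    have hadd : Summable fun j => β j + β j * α (k - j) ^ 2 := hβ.add (hS k)
    have hle : ∀ j, β j * α (k - j) ≤ β j + β j * α (k - j) ^ 2 := fun j => by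
      nlinarith [mul_nonneg (hβ0 j) (sq_nonneg (α (k - j) - 1 / 2)), hβ0 j]
    exact hadd.of_nonneg_of_le (fun j => mul_nonneg (hβ0 j) (hα0 (k - j))) hle
  refine ⟨hT, ?_⟩
  have hbound : Summable fun k => (∑' j, β j + 1) * ∑' j, β j * α (k - j) ^ 2 :=
    hprod'.prod.mul_left _
  exact hbound.of_nonneg_of_le (fun k => sq_nonneg (∑' j, β j * α (k - j))) fun k =>
    sq_le_of_hasSum hβ0 hβ (hT k).hasSum (hS k).hasSum

/-- If |a| ≤ |b| then |a + b| ≤ 2|b|, so the weight of the sum is controlled by that of the larger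
summand. -/
theorem sobolev_weight_add_le {r : ℝ} (hr : 0 ≤ r) (j k : ℤ) :
    (1 + ((j + k : ℤ) : ℝ) ^ 2) ^ r ≤
      4 ^ r * ((1 + (j : ℝ) ^ 2) ^ r + (1 + (k : ℝ) ^ 2) ^ r) := by
  have aux : ∀ a b : ℝ, |a| ≤ |b| →
      (1 + (a + b) ^ 2) ^ r ≤ 4 ^ r * ((1 + a ^ 2) ^ r + (1 + b ^ 2) ^ r) := by
    intro a b hab
    have h1 : a ^ 2 ≤ b ^ 2 := sq_le_sq.2 hab
    calc (1 + (a + b) ^ 2) ^ r ≤ (4 * (1 + b ^ 2)) ^ r :=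
          Real.rpow_le_rpow (by positivity) (by nlinarith [sq_nonneg (a - b)]) hr
      _ = 4 ^ r * (1 + b ^ 2) ^ r := Real.mul_rpow (by norm_num) (by positivity)
      _ ≤ _ := by
        refine mul_le_mul_of_nonneg_left ?_ (by positivity)
        have : 0 ≤ (1 + a ^ 2) ^ r := by positivity
        linarith
  push_cast
  rcases le_total |(j : ℝ)| |(k : ℝ)| with h | h
  · exact aux _ _ h
  · rw [add_comm (j : ℝ), add_comm ((1 + (j : ℝ) ^ 2) ^ r)]
    exact aux _ _ h

/-- The weight of index k splits over j and k - j, so the weighted coefficients of fg are bounded by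
two convolutions, each of an ℓ¹ sequence with an ℓ² one; Young's inequality applies to both. -/
theorem MemHs.mul {s : ℝ} (hs : 1 / 2 < s) {f g : Circle → ℂ} (hf : MemHs s f)
    (hg : MemHs s g) : MemHs s fun z => f z * g z := by
  refine ⟨hf.1.mul hg.1, ?_⟩
  -- The exponent is s / 2 because the Sobolev sum carries v² against squared coefficients.
  set v : ℤ → ℝ := fun k => (1 + (k : ℝ) ^ 2) ^ (s / 2) with hv
  have hv0 : ∀ k, 0 ≤ v k := fun k => by positivity
  have hv2 : ∀ k : ℤ, (1 + (k : ℝ) ^ 2) ^ s = v k ^ 2 := fun k => by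
    simp only [hv]
    rw [← Real.rpow_mul_natCast (by positivity)]
    congr 1; push_cast; ring
  have hA : Summable fun k => (v k * ‖fc f k‖) ^ 2 := by
    simpa only [hv2, ← mul_pow] using hf.2
  have hB : Summable fun k => (v k * ‖fc g k‖) ^ 2 := by
    simpa only [hv2, ← mul_pow] using hg.2
  obtain ⟨hP1, hP2⟩ := summable_sq_conv (fun k => norm_nonneg (fc g k)) (hg.summable hs)
    (fun k => mul_nonneg (hv0 k) (norm_nonneg (fc f k))) hA
  obtain ⟨hQ1, hQ2⟩ := summable_sq_conv (fun k => norm_nonneg (fc f k)) (hf.summable hs)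
    (fun k => mul_nonneg (hv0 k) (norm_nonneg (fc g k))) hB
  refine Summable.of_nonneg_of_le (fun k => by positivity) (fun k => ?_)
    ((hP2.add hQ2).mul_left (2 * (4 ^ (s / 2)) ^ 2))
  set P := ∑' j, ‖fc g j‖ * (v (k - j) * ‖fc f (k - j)‖) with hPdef
  set Q := ∑' j, ‖fc f j‖ * (v (k - j) * ‖fc g (k - j)‖) with hQdef
  have hP' : HasSum (fun j => ‖fc g (k - j)‖ * (v j * ‖fc f j‖)) P := by
    have := (Equiv.subLeft k).hasSum_iff.2 (hP1 k).hasSum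
    refine this.congr_fun ?_
    intro j
    simp
  have hmul := hasSum_fc_mul (hf.summable hs) (hasSum_fc hf.1 (hf.summable hs)) hg.1 k
  have hle : v k * ‖fc (fun z => f z * g z) k‖ ≤ 4 ^ (s / 2) * (P + Q) := by
    have hsum := (hP'.add (hQ1 k).hasSum).mul_left (4 ^ (s / 2))
    have h1 := hmul.mul_left ((v k : ℝ) : ℂ)
    have h2 := h1.norm_le_of_bounded hsum fun j => ?_
    · rwa [norm_mul, Complex.norm_real, Real.norm_of_nonneg (hv0 k)] at h2
    · have h3 := sobolev_weight_add_le (r := s / 2) (by linarith) j (k - j)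
      rw [add_sub_cancel] at h3
      rw [norm_mul, norm_mul, Complex.norm_real, Real.norm_of_nonneg (hv0 k)]
      calc v k * (‖fc f j‖ * ‖fc g (k - j)‖)
          ≤ (4 ^ (s / 2) * (v j + v (k - j))) * (‖fc f j‖ * ‖fc g (k - j)‖) :=
            mul_le_mul_of_nonneg_right h3 (by positivity)
        _ = _ := by ring
  rw [hv2, ← mul_pow]
  calc (v k * ‖fc (fun z => f z * g z) k‖) ^ 2 ≤ (4 ^ (s / 2) * (P + Q)) ^ 2 :=
        pow_le_pow_left₀ (mul_nonneg (hv0 k) (norm_nonneg _)) hle 2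
    _ = (4 ^ (s / 2)) ^ 2 * (P + Q) ^ 2 := by ring
    _ ≤ (4 ^ (s / 2)) ^ 2 * (2 * (P ^ 2 + Q ^ 2)) :=
        mul_le_mul_of_nonneg_left (by nlinarith [sq_nonneg (P - Q)]) (by positivity)
    _ = _ := by ring

/-! ### Linear operations, conjugation and inversion on Fourier coefficients -/

theorem fc_add {f g : Circle → ℂ} (hf : Continuous f) (hg : Continuous g) (k : ℤ) :
    fc (fun z => f z + g z) k = fc f k + fc g k := by
  have hi : ∀ {f : Circle → ℂ}, Continuous f → Integrable
      (fun t : UnitAddCircle => f (AddCircle.toCircle t)) haarAddCircle := fun hf =>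
    (hf.comp AddCircle.continuous_toCircle).integrable_of_hasCompactSupport
      (HasCompactSupport.of_compactSpace _)
  exact congrFun (fourierCoeff.add (hi hf) (hi hg)) k

theorem fc_const_mul (c : ℂ) (f : Circle → ℂ) (k : ℤ) :
    fc (fun z => c * f z) k = c * fc f k :=
  fourierCoeff.const_mul (fun t : UnitAddCircle => f (AddCircle.toCircle t)) c k

theorem MemHs.add {s : ℝ} {f g : Circle → ℂ} (hf : MemHs s f) (hg : MemHs s g) :
    MemHs s fun z => f z + g z := by
  refine ⟨hf.1.add hg.1, Summable.of_nonneg_of_le (fun k => by positivity) (fun k => ?_)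
    ((hf.2.add hg.2).mul_left 2)⟩
  rw [fc_add hf.1 hg.1, ← mul_add, ← mul_assoc, mul_comm 2, mul_assoc]
  refine mul_le_mul_of_nonneg_left ?_ (by positivity)
  have := norm_add_le (fc f k) (fc g k)
  calc ‖fc f k + fc g k‖ ^ 2 ≤ (‖fc f k‖ + ‖fc g k‖) ^ 2 :=
        pow_le_pow_left₀ (norm_nonneg _) this 2
    _ ≤ _ := by nlinarith [sq_nonneg (‖fc f k‖ - ‖fc g k‖)]

theorem MemHs.const_mul {s : ℝ} (c : ℂ) {f : Circle → ℂ} (hf : MemHs s f) :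
    MemHs s fun z => c * f z := by
  refine ⟨continuous_const.mul hf.1, (hf.2.mul_left (‖c‖ ^ 2)).congr fun k => ?_⟩
  rw [fc_const_mul, norm_mul]
  ring

theorem memHs_of_finite {s : ℝ} {f : Circle → ℂ} (hf : Continuous f)
    (h : (Function.support (fc f)).Finite) : MemHs s f :=
  ⟨hf, summable_of_hasFiniteSupport (h.subset fun k hk => by
    simp only [Function.mem_support] at hk ⊢
    contrapose! hk
    simp [hk])⟩

theorem fc_const (c : ℂ) (k : ℤ) : fc (fun _ => c) k = if k = 0 then c else 0 := by
  have := fc_const_mul c (fun _ => 1) k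
  simp only [mul_one, fc_one] at this
  rw [this]
  split_ifs <;> simp

theorem memHs_const (s : ℝ) (c : ℂ) : MemHs s fun _ => c :=
  memHs_of_finite continuous_const ((Set.finite_singleton 0).subset fun k hk => by
    by_contra h
    exact hk (by rw [fc_const]; exact if_neg h))

theorem fc_conj {f : Circle → ℂ} (hf : Continuous f) (hs : Summable fun k => ‖fc f k‖)
    (k : ℤ) : fc (fun z => star (f z)) k = star (fc f (-k)) := by
  refine congrFun (fc_of_hasSum (a := fun k => star (fc f (-k))) ?_ fun z => ?_) k
  · simp only [norm_star]
    exact hs.comp_injective neg_injective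
  · have h := (Equiv.neg ℤ).hasSum_iff.2 (hasSum_fc hf hs z).star
    refine h.congr_fun fun k => ?_
    simp only [Function.comp_apply, Equiv.neg_apply, star_mul', star_zpow₀]
    congr 1
    rw [_root_.zpow_neg, ← _root_.inv_zpow]
    congr 1
    have : star (z : ℂ) = (z : ℂ)⁻¹ := (Circle.coe_inv_eq_conj z).symm.trans (Circle.coe_inv z)
    rw [this, inv_inv]

theorem fc_inv {f : Circle → ℂ} (hf : Continuous f) (hs : Summable fun k => ‖fc f k‖)
    (k : ℤ) : fc (fun z => f z⁻¹) k = fc f (-k) := by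
  refine congrFun (fc_of_hasSum (a := fun k => fc f (-k)) ?_ fun z => ?_) k
  · exact hs.comp_injective neg_injective
  · have h := (Equiv.neg ℤ).hasSum_iff.2 (hasSum_fc hf hs z⁻¹)
    refine h.congr_fun fun k => ?_
    simp

theorem MemHs.conj {s : ℝ} (hs : 1 / 2 < s) {f : Circle → ℂ} (hf : MemHs s f) :
    MemHs s fun z => star (f z) := by
  refine ⟨continuous_star.comp hf.1, ?_⟩
  have h := hf.2.comp_injective (neg_injective (G := ℤ))
  refine h.congr fun k => ?_
  rw [fc_conj hf.1 (hf.summable hs)]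
  simp

/-! ### Holomorphic extensions -/

theorem fc_eq_circleAverage (f : ℂ → ℂ) (k : ℤ) :
    fc (fun z => f z) k = Real.circleAverage (fun z => z ^ (-k) * f z) 0 1 := by
  unfold fc
  rw [fourierCoeff_eq_intervalIntegral _ _ 0, Real.circleAverage]
  have h := intervalIntegral.integral_comp_mul_left (a := 0) (b := 1)
    (fun θ : ℝ => (circleMap 0 1 θ) ^ (-k) * f (circleMap 0 1 θ))
    (c := 2 * Real.pi) (by positivity)
  rw [mul_zero, mul_one] at h
  rw [← h, div_one, one_smul, zero_add]
  refine intervalIntegral.integral_congr fun t _ => ?_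
  have : ((AddCircle.toCircle (t : UnitAddCircle) : Circle) : ℂ) =
      circleMap 0 1 (2 * Real.pi * t) := by
    rw [AddCircle.toCircle_apply_mk]
    simp [circleMap]
  simp only [fourier_eq_toCircle_zpow, this, smul_eq_mul]

/-- By the mean value property the coefficient of index -m is the value at 0 of z^m f(z), that is
0^m f(0); m > 0 and m = 0 give the two claims. -/
theorem fc_of_extension {x : Circle → ℂ} {f : ℂ → ℂ} (hf : DiffContOnCl ℂ f (ball 0 1))
    (hx : ∀ z : Circle, f z = x z) : (∀ k < 0, fc x k = 0) ∧ fc x 0 = f 0 := by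
  have hx' : x = fun z : Circle => f z := funext fun z => (hx z).symm
  have h : ∀ m : ℕ, fc x (-(m : ℤ)) = (0 : ℂ) ^ m * f 0 := by
    intro m
    rw [hx', fc_eq_circleAverage]
    have hd : DiffContOnCl ℂ (fun z : ℂ => z ^ m * f z) (ball 0 |1|) := by
      rw [abs_one]
      exact (Differentiable.diffContOnCl (differentiable_id.pow m)).smul hf
    simpa using hd.circleAverage
  refine ⟨fun k hk => ?_, by simpa using h 0⟩
  obtain ⟨m, rfl⟩ : ∃ m : ℕ, k = -(m : ℤ) := ⟨k.natAbs, by omega⟩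
  rw [h m, zero_pow (by omega), zero_mul]

/-- The power series with the given coefficients converges uniformly on the closed disk, by absolute
summability. -/
theorem exists_extension {x : Circle → ℂ} (hx : Continuous x) (hs : Summable fun k => ‖fc x k‖)
    (h0 : ∀ k < 0, fc x k = 0) : ∃ f : ℂ → ℂ, DiffContOnCl ℂ f (ball 0 1) ∧
      (∀ z : Circle, f z = x z) ∧ f 0 = fc x 0 := by
  have hsN : Summable fun m : ℕ => ‖fc x m‖ := hs.comp_injective Nat.cast_injective
  have hle : ∀ (m : ℕ) (w : ℂ), w ∈ closedBall (0 : ℂ) 1 → ‖fc x m * w ^ m‖ ≤ ‖fc x m‖ := by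
    intro m w hw
    rw [norm_mul, norm_pow]
    exact mul_le_of_le_one_right (norm_nonneg _)
      (pow_le_one₀ (norm_nonneg _) (mem_closedBall_zero_iff.1 hw))
  refine ⟨fun w => ∑' m : ℕ, fc x m * w ^ m, ⟨?_, ?_⟩, fun z => ?_, ?_⟩
  · exact differentiableOn_tsum_of_summable_norm hsN (fun m => by fun_prop) isOpen_ball
      fun m w hw => hle m w (ball_subset_closedBall hw)
  · rw [closure_ball _ one_ne_zero]
    exact continuousOn_tsum (fun m => by fun_prop) hsN hle
  · have h := hasSum_fc hx hs z
    have hinj : Function.Injective (Nat.cast : ℕ → ℤ) := Nat.cast_injective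
    have h' := (hinj.hasSum_iff (fun k hk => by
      rw [h0 k (by
        by_contra hk'
        exact hk ⟨k.toNat, by simp [not_lt.1 hk']⟩), zero_mul])).2 h
    simpa using h'.tsum_eq
  · dsimp only
    rw [tsum_eq_single 0 fun m hm => by rw [zero_pow hm, mul_zero]]
    simp

end FourierSeries

/-! ### Matrix-valued loops -/

theorem isHs_iff {s : ℝ} {x : Loop} : IsHs s x ↔ ∀ i j, MemHs s fun z => x z i j := by
  constructor
  · exact fun h i j => ⟨h.1.matrix_elem i j, h.2 i j⟩
  · exact fun h => ⟨continuous_matrix fun i j => (h i j).1, fun i j => (h i j).2⟩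

theorem IsHs.mul {s : ℝ} (hs : 1 / 2 < s) {x y : Loop} (hx : IsHs s x) (hy : IsHs s y) :
    IsHs s (x * y) := by
  rw [isHs_iff] at *
  intro i j
  have h := ((hx i 0).mul hs (hy 0 j)).add ((hx i 1).mul hs (hy 1 j))
  have e : (fun z => (x * y) z i j) = fun z => x z i 0 * y z 0 j + x z i 1 * y z 1 j := by
    funext z
    rw [Pi.mul_apply, Matrix.mul_apply, Fin.sum_univ_two]
  rwa [e]

theorem isHs_const (s : ℝ) (m : M2) : IsHs s fun _ => m :=
  isHs_iff.2 fun i j => memHs_const s (m i j)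

theorem coeff_const (m : M2) (k : ℤ) : coeff (fun _ => m) k = if k = 0 then m else 0 := by
  ext i j
  rw [coeff_apply, fc_const]
  split_ifs <;> rfl

theorem IsHs.smul {s : ℝ} (c : ℂ) {x : Loop} (hx : IsHs s x) : IsHs s (c • x) :=
  isHs_iff.2 fun i j => (isHs_iff.1 hx i j).const_mul c

theorem coeff_smul (c : ℂ) (x : Loop) : coeff (c • x) = c • coeff x := by
  funext k
  ext i j
  exact fc_const_mul c (fun z => x z i j) k

theorem hasSum_coeff_mul {s : ℝ} (hs : 1 / 2 < s) {x y : Loop} (hx : IsHs s x) (hy : IsHs s y)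
    (k : ℤ) : HasSum (fun j => coeff x j * coeff y (k - j)) (coeff (x * y) k) := by
  rw [isHs_iff] at hx hy
  refine Pi.hasSum.2 fun i => Pi.hasSum.2 fun j => ?_
  have hp : ∀ l, HasSum (fun m => fc (fun z => x z i l) m * fc (fun z => y z l j) (k - m))
      (fc (fun z => x z i l * y z l j) k) := fun l =>
    hasSum_fc_mul ((hx i l).summable hs) (hasSum_fc (hx i l).1 ((hx i l).summable hs))
      (hy l j).1 k
  have h := (hp 0).add (hp 1)
  rw [← fc_add ((hx i 0).mul hs (hy 0 j)).1 ((hx i 1).mul hs (hy 1 j)).1] at h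
  have e : (fun z => (x * y) z i j) = fun z => x z i 0 * y z 0 j + x z i 1 * y z 1 j := by
    funext z
    rw [Pi.mul_apply, Matrix.mul_apply, Fin.sum_univ_two]
  rw [coeff_apply, e]
  refine h.congr_fun fun m => ?_
  rw [Matrix.mul_apply, Fin.sum_univ_two]
  rfl

theorem coeff_mul {s : ℝ} (hs : 1 / 2 < s) {x y : Loop} (hx : IsHs s x) (hy : IsHs s y) :
    coeff (x * y) = conv (coeff x) (coeff y) :=
  funext fun k => (hasSum_coeff_mul hs hx hy k).tsum_eq.symm

theorem coeff_ext {s : ℝ} (hs : 1 / 2 < s) {x y : Loop} (hx : IsHs s x) (hy : IsHs s y)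
    (h : coeff x = coeff y) : x = y := by
  rw [isHs_iff] at hx hy
  funext z
  ext i j
  have := fc_ext (hx i j).1 (hy i j).1 ((hx i j).summable hs) fun k => by
    rw [← coeff_apply, ← coeff_apply, h]
  exact congrFun this z

/-- In these degrees at most one term of the sum is nonzero, so no convergence is needed and the
rule holds for formal series. -/
theorem conv_of_ge {a b : ℤ → M2} {p q : ℤ} (ha : ∀ j < p, a j = 0) (hb : ∀ j < q, b j = 0) :
    (∀ k < p + q, conv a b k = 0) ∧ conv a b (p + q) = a p * b q := by
  have h0 : ∀ k j, (j < p ∨ k - j < q) → a j * b (k - j) = 0 := by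
    rintro k j (h | h)
    · rw [ha j h, zero_mul]
    · rw [hb _ h, mul_zero]
  refine ⟨fun k hk => ?_, ?_⟩
  · have : (fun j => a j * b (k - j)) = fun _ => 0 := funext fun j => h0 k j (by omega)
    rw [conv, this, tsum_zero]
  · rw [conv, tsum_eq_single p fun j hj => h0 _ j (by omega), add_sub_cancel_left]

theorem conv_of_le {a b : ℤ → M2} {p q : ℤ} (ha : ∀ j > p, a j = 0) (hb : ∀ j > q, b j = 0) :
    (∀ k > p + q, conv a b k = 0) ∧ conv a b (p + q) = a p * b q := by
  have h0 : ∀ k j, (p < j ∨ q < k - j) → a j * b (k - j) = 0 := by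
    rintro k j (h | h)
    · rw [ha j h, zero_mul]
    · rw [hb _ h, mul_zero]
  refine ⟨fun k hk => ?_, ?_⟩
  · have : (fun j => a j * b (k - j)) = fun _ => 0 := funext fun j => h0 k j (by omega)
    rw [conv, this, tsum_zero]
  · rw [conv, tsum_eq_single p fun j hj => h0 _ j (by omega), add_sub_cancel_left]

/-! ### The adjugate and the involution `ρ` -/

/-- The pointwise adjugate. -/
def adjLoop (x : Loop) : Loop := fun z => (x z).adjugate

/-- `ρ` on matrices. -/
def rhoMat (g : M2) : M2 := sigma3 * gᴴ * sigma3

/-- `ρ` on loops. -/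
def rhoLoop (x : Loop) : Loop := fun z => rhoMat (x z)

theorem rhoMat_apply (g : M2) :
    rhoMat g = !![star (g 0 0), -star (g 1 0); -star (g 0 1), star (g 1 1)] := by
  unfold rhoMat
  rw [Matrix.eta_fin_two (gᴴ), sigma3]
  simp [Matrix.conjTranspose_apply]

theorem sigma3_mul_self : sigma3 * sigma3 = 1 := by
  rw [sigma3, Matrix.one_fin_two]
  simp

theorem det_sigma3 : sigma3.det = -1 := by simp [sigma3, Matrix.det_fin_two]

theorem rhoMat_mul (g h : M2) : rhoMat (g * h) = rhoMat h * rhoMat g := by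
  unfold rhoMat
  rw [Matrix.conjTranspose_mul]
  calc sigma3 * (hᴴ * gᴴ) * sigma3 = sigma3 * hᴴ * 1 * gᴴ * sigma3 := by
        simp only [mul_assoc, one_mul]
    _ = _ := by rw [← sigma3_mul_self]; simp only [mul_assoc]

theorem rhoMat_rhoMat (g : M2) : rhoMat (rhoMat g) = g := by
  rw [rhoMat_apply (rhoMat g), rhoMat_apply g, Matrix.eta_fin_two g]
  simp

theorem rhoMat_one : rhoMat 1 = 1 := by
  unfold rhoMat
  rw [Matrix.conjTranspose_one, mul_one, sigma3_mul_self]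

theorem det_rhoMat (g : M2) : (rhoMat g).det = star g.det := by
  simp only [rhoMat, Matrix.det_mul, det_sigma3, Matrix.det_conjTranspose]
  ring

theorem rhoMat_adjugate (g : M2) : rhoMat g.adjugate = (rhoMat g).adjugate := by
  rw [rhoMat_apply, rhoMat_apply, Matrix.adjugate_fin_two_of, Matrix.adjugate_fin_two]
  simp

theorem adjugate_neg_two (g : M2) : (-g).adjugate = -g.adjugate := by
  rw [Matrix.adjugate_fin_two, Matrix.adjugate_fin_two]
  simp

theorem adjugate_adjugate_two (g : M2) : g.adjugate.adjugate = g := by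
  rw [Matrix.adjugate_fin_two g, Matrix.adjugate_fin_two_of, neg_neg, neg_neg,
    ← Matrix.eta_fin_two g]

theorem mul_adjugate_of_det {g : M2} (h : g.det = 1) : g * g.adjugate = 1 := by
  rw [Matrix.mul_adjugate, h, one_smul]

theorem adjugate_mul_of_det {g : M2} (h : g.det = 1) : g.adjugate * g = 1 := by
  rw [Matrix.adjugate_mul, h, one_smul]

theorem inv_of_det {g : M2} (h : g.det = 1) : g⁻¹ = g.adjugate := by
  rw [Matrix.inv_def, h, Ring.inverse_one, one_smul]

theorem det_adjugate_two {g : M2} : g.adjugate.det = g.det := by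
  rw [Matrix.det_adjugate]
  simp

/-- Trades τ for ρ: for determinant 1, τ(g) = ±g becomes ρ(g) = ± adj g. Both sides are then real
linear in the 2 × 2 case and act on coefficients. -/
theorem tau_eq (g : M2) : tau g = (rhoMat g)⁻¹ := by
  have hs : sigma3⁻¹ = sigma3 := Matrix.inv_eq_left_inv sigma3_mul_self
  rw [tau, rhoMat, Matrix.mul_inv_rev, Matrix.mul_inv_rev, hs, mul_assoc]

theorem tau_eq_iff {g : M2} (h : g.det = 1) : tau g = g ↔ rhoMat g = g.adjugate := by
  have hr : (rhoMat g).det = 1 := by rw [det_rhoMat, h, star_one]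
  rw [tau_eq, inv_of_det hr]
  constructor
  · intro e
    rw [← adjugate_adjugate_two (rhoMat g), e]
  · intro e
    rw [e, adjugate_adjugate_two]

theorem tau_eq_neg_iff {g : M2} (h : g.det = 1) : tau g = -g ↔ rhoMat g = -g.adjugate := by
  have hr : (rhoMat g).det = 1 := by rw [det_rhoMat, h, star_one]
  rw [tau_eq, inv_of_det hr]
  constructor
  · intro e
    rw [← adjugate_adjugate_two (rhoMat g), e, adjugate_neg_two]
  · intro e
    rw [e, adjugate_neg_two, adjugate_adjugate_two]

theorem adjLoop_eq {s : ℝ} {x : Loop} (hx : IsHs s x) :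
    IsHs s (adjLoop x) ∧ coeff (adjLoop x) = adj (coeff x) := by
  rw [isHs_iff] at hx
  have h1 : ∀ i j, MemHs s (fun z => -x z i j) ∧
      ∀ k, fc (fun z => -x z i j) k = -fc (fun z => x z i j) k := by
    intro i j
    have e : (fun z => -x z i j) = fun z => -1 * x z i j := by simp
    rw [e]
    exact ⟨(hx i j).const_mul (-1), fun k => by rw [fc_const_mul, neg_one_mul]⟩
  constructor
  · rw [isHs_iff]
    intro i j
    simp only [adjLoop, Matrix.adjugate_fin_two]
    fin_cases i <;> fin_cases j
    · exact hx 1 1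
    · exact (h1 0 1).1
    · exact (h1 1 0).1
    · exact hx 0 0
  · funext k
    ext i j
    rw [coeff_apply]
    simp only [adjLoop, adj, Matrix.adjugate_fin_two]
    fin_cases i <;> fin_cases j
    · rfl
    · exact (h1 0 1).2 k
    · exact (h1 1 0).2 k
    · rfl

theorem rhoLoop_eq {s : ℝ} (hs : 1 / 2 < s) {x : Loop} (hx : IsHs s x) :
    IsHs s (rhoLoop x) ∧ coeff (rhoLoop x) = rho (coeff x) := by
  rw [isHs_iff] at hx
  have h0 : ∀ i j, MemHs s (fun z => star (x z i j)) ∧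
      ∀ k, fc (fun z => star (x z i j)) k = star (fc (fun z => x z i j) (-k)) := fun i j =>
    ⟨(hx i j).conj hs, fun k => fc_conj (hx i j).1 ((hx i j).summable hs) k⟩
  have h1 : ∀ i j, MemHs s (fun z => -star (x z i j)) ∧
      ∀ k, fc (fun z => -star (x z i j)) k = -star (fc (fun z => x z i j) (-k)) := by
    intro i j
    have e : (fun z => -star (x z i j)) = fun z => -1 * star (x z i j) := by simp
    rw [e]
    exact ⟨(h0 i j).1.const_mul (-1), fun k => by rw [fc_const_mul, neg_one_mul, (h0 i j).2]⟩
  constructor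
  · rw [isHs_iff]
    intro i j
    simp only [rhoLoop, rhoMat_apply]
    fin_cases i <;> fin_cases j
    · exact (h0 0 0).1
    · exact (h1 1 0).1
    · exact (h1 0 1).1
    · exact (h0 1 1).1
  · funext k
    change _ = rhoMat (coeff x (-k))
    ext i j
    rw [coeff_apply]
    simp only [rhoLoop, rhoMat_apply]
    fin_cases i <;> fin_cases j
    · exact (h0 0 0).2 k
    · exact (h1 1 0).2 k
    · exact (h1 0 1).2 k
    · exact (h0 1 1).2 k

theorem rho_apply (a : ℤ → M2) (k : ℤ) : rho a k = rhoMat (a (-k)) := rfl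

theorem inv_eq_adjLoop {x : Loop} (h : ∀ z, (x z).det = 1) : x⁻¹ = adjLoop x :=
  funext fun z => inv_of_det (h z)

theorem mul_adjLoop {x : Loop} (h : ∀ z, (x z).det = 1) : x * adjLoop x = 1 :=
  funext fun z => mul_adjugate_of_det (h z)

theorem adjLoop_mul_self {x : Loop} (h : ∀ z, (x z).det = 1) : adjLoop x * x = 1 :=
  funext fun z => adjugate_mul_of_det (h z)

theorem LambdaGC.mul {s : ℝ} (hs : 1 / 2 < s) {x y : Loop} (hx : x ∈ LambdaGC s)
    (hy : y ∈ LambdaGC s) : x * y ∈ LambdaGC s :=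
  ⟨hx.1.mul hs hy.1, fun z => by rw [Pi.mul_apply, Matrix.det_mul, hx.2, hy.2, one_mul]⟩

theorem LambdaGC.adj {s : ℝ} {x : Loop} (hx : x ∈ LambdaGC s) :
    adjLoop x ∈ LambdaGC s :=
  ⟨(adjLoop_eq hx.1).1, fun z => det_adjugate_two.trans (hx.2 z)⟩

theorem LambdaGC.rho {s : ℝ} (hs : 1 / 2 < s) {x : Loop} (hx : x ∈ LambdaGC s) :
    rhoLoop x ∈ LambdaGC s :=
  ⟨(rhoLoop_eq hs hx.1).1, fun z => by rw [rhoLoop, det_rhoMat, hx.2, star_one]⟩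

/-! ### Loops extending to one of the disks -/

/-- No negative Fourier coefficients. -/
def Plus (x : Loop) : Prop := ∀ k < 0, coeff x k = 0

/-- No positive Fourier coefficients. -/
def Minus (x : Loop) : Prop := ∀ k > 0, coeff x k = 0

/-- The predicate `P` serves both normalizations at 0: zero lower left entry, and membership in
`TriReal`. -/
theorem exists_isPlusExtension_iff {s : ℝ} (hs : 1 / 2 < s) {x : Loop} (hx : IsHs s x)
    {P : M2 → Prop} :
    (∃ f, IsPlusExtension x f ∧ P (f 0)) ↔ Plus x ∧ P (coeff x 0) := by
  constructor
  · rintro ⟨f, hf, hP⟩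
    have h := fun i j => fc_of_extension (hf.1 i j) (x := fun z => x z i j)
      fun z => by rw [hf.2]
    refine ⟨fun k hk => by ext i j; exact (h i j).1 k hk, ?_⟩
    have e : coeff x 0 = f 0 := by ext i j; exact (h i j).2
    rwa [e]
  · rintro ⟨hp, hP⟩
    rw [isHs_iff] at hx
    choose f hf using fun i j => exists_extension (hx i j).1 ((hx i j).summable hs)
      fun k hk => by rw [← coeff_apply, hp k hk, Matrix.zero_apply]
    refine ⟨fun z => Matrix.of fun i j => f i j z, ⟨fun i j => (hf i j).1, fun z => ?_⟩, ?_⟩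
    · ext i j
      exact (hf i j).2.1 z
    · have e : (Matrix.of fun i j => f i j 0 : M2) = coeff x 0 := by
        ext i j
        exact (hf i j).2.2
      exact (congrArg P e).mpr hP

/-- The extension at ∞ is an ordinary extension of z ↦ x(z⁻¹), whose coefficients are those of x
with reversed index. -/
theorem minus_of_isMinusExtension {s : ℝ} (hs : 1 / 2 < s) {x : Loop} (hx : IsHs s x)
    {f : ℂ → M2} (hf : IsMinusExtension x f) : Minus x ∧ coeff x 0 = f 0 := by
  rw [isHs_iff] at hx
  have h := fun i j => fc_of_extension (hf.1 i j) (x := fun z => x z⁻¹ i j)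
    fun z => by rw [← hf.2]; simp
  have h2 := fun i j => fc_inv (hx i j).1 ((hx i j).summable hs)
  constructor
  · intro k hk
    ext i j
    have h3 := (h i j).1 (-k) (by omega)
    rw [h2 i j, neg_neg] at h3
    exact h3
  · ext i j
    rw [← (h i j).2, h2 i j, neg_zero]
    rfl

theorem mem_lambdaPlusReal_iff {s : ℝ} (hs : 1 / 2 < s) {x : Loop} :
    x ∈ LambdaPlusReal s ↔ x ∈ LambdaGC s ∧ Plus x ∧ coeff x 0 ∈ TriReal := by
  exact and_congr_right fun hx => exists_isPlusExtension_iff hs hx.1 (P := (· ∈ TriReal))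

theorem mem_lambdaPlusTri_iff {s : ℝ} (hs : 1 / 2 < s) {x : Loop} :
    x ∈ LambdaPlusTri s ↔ x ∈ LambdaGC s ∧ Plus x ∧ coeff x 0 1 0 = 0 := by
  exact and_congr_right fun hx =>
    exists_isPlusExtension_iff hs hx.1 (P := fun m => m 1 0 = 0)

theorem Plus.mul {s : ℝ} (hs : 1 / 2 < s) {x y : Loop} (hx : IsHs s x) (hy : IsHs s y)
    (hpx : Plus x) (hpy : Plus y) : Plus (x * y) ∧ coeff (x * y) 0 = coeff x 0 * coeff y 0 := by
  have h := conv_of_ge hpx hpy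
  rw [add_zero, ← coeff_mul hs hx hy] at h
  exact h

theorem Minus.mul {s : ℝ} (hs : 1 / 2 < s) {x y : Loop} (hx : IsHs s x) (hy : IsHs s y)
    (hpx : Minus x) (hpy : Minus y) :
    Minus (x * y) ∧ coeff (x * y) 0 = coeff x 0 * coeff y 0 := by
  have h := conv_of_le hpx hpy
  rw [add_zero, ← coeff_mul hs hx hy] at h
  exact h

theorem adjugate_zero_two : (0 : M2).adjugate = 0 := by
  rw [Matrix.adjugate_fin_two]
  ext i j
  fin_cases i <;> fin_cases j <;> simp

theorem rhoMat_zero : rhoMat 0 = 0 := by simp [rhoMat]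

theorem Plus.adj {s : ℝ} {x : Loop} (hx : IsHs s x) (h : Plus x) :
    Plus (adjLoop x) := fun k hk => by
  rw [(adjLoop_eq hx).2, LoopIwasawa.adj, h k hk, adjugate_zero_two]

theorem Minus.adj {s : ℝ} {x : Loop} (hx : IsHs s x) (h : Minus x) :
    Minus (adjLoop x) := fun k hk => by
  rw [(adjLoop_eq hx).2, LoopIwasawa.adj, h k hk, adjugate_zero_two]

theorem Plus.rho {s : ℝ} (hs : 1 / 2 < s) {x : Loop} (hx : IsHs s x) (h : Plus x) :
    Minus (rhoLoop x) := fun k hk => by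
  rw [(rhoLoop_eq hs hx).2, rho_apply, h _ (by omega), rhoMat_zero]

theorem Minus.rho {s : ℝ} (hs : 1 / 2 < s) {x : Loop} (hx : IsHs s x) (h : Minus x) :
    Plus (rhoLoop x) := fun k hk => by
  rw [(rhoLoop_eq hs hx).2, rho_apply, h _ (by omega), rhoMat_zero]

theorem coeff_adjLoop_zero {s : ℝ} {x : Loop} (hx : IsHs s x) :
    coeff (adjLoop x) 0 = (coeff x 0).adjugate := by
  rw [(adjLoop_eq hx).2, adj]

theorem coeff_rhoLoop_zero {s : ℝ} (hs : 1 / 2 < s) {x : Loop} (hx : IsHs s x) :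
    coeff (rhoLoop x) 0 = rhoMat (coeff x 0) := by
  rw [(rhoLoop_eq hs hx).2, rho_apply, neg_zero]

/-- Liouville's theorem in Fourier form; existence, uniqueness and the kernel computation all end
here. -/
theorem eq_const_of_plus_of_minus {s : ℝ} (hs : 1 / 2 < s) {x : Loop} (hx : IsHs s x)
    (hp : Plus x) (hm : Minus x) : x = fun _ => coeff x 0 := by
  refine coeff_ext hs hx (isHs_const s _) (funext fun k => ?_)
  rw [coeff_const]
  split_ifs with h
  · rw [h]
  · rcases lt_or_gt_of_ne h with h | h
    · exact hp k h
    · exact hm k h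

/-- Taking constant coefficients is multiplicative on plus loops, so x · adj x = 1 passes to the
value at 0. -/
theorem det_coeff_zero {s : ℝ} (hs : 1 / 2 < s) {x : Loop} (hx : x ∈ LambdaGC s)
    (hp : Plus x) : (coeff x 0).det = 1 := by
  have h := (Plus.mul hs hx.1 (LambdaGC.adj hx).1 hp (hp.adj hx.1)).2
  rw [mul_adjLoop hx.2, coeff_adjLoop_zero hx.1, Matrix.mul_adjugate] at h
  have h1 : coeff (1 : Loop) 0 = 1 := by
    have := coeff_const 1 0
    rwa [if_pos rfl] at this
  rw [h1] at h
  have := congrFun (congrFun h 0) 0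
  simpa using this.symm

/-! ### The two components of `Λ G` -/

/-- The loops with `ρ x = ε x⁻¹`. For `ε = ±1` these are the two components of `Λ G`. -/
def SignedG (s : ℝ) (ε : ℂ) : Set Loop :=
  {x | x ∈ LambdaGC s ∧ ∀ z, rhoMat (x z) = ε • (x z).adjugate}

theorem SignedG.mul {s : ℝ} (hs : 1 / 2 < s) {ε δ : ℂ} {x y : Loop} (hx : x ∈ SignedG s ε)
    (hy : y ∈ SignedG s δ) : x * y ∈ SignedG s (ε * δ) := by
  refine ⟨LambdaGC.mul hs hx.1 hy.1, fun z => ?_⟩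
  rw [Pi.mul_apply, rhoMat_mul, hx.2, hy.2, Matrix.adjugate_mul_distrib, Matrix.smul_mul,
    Matrix.mul_smul, smul_smul, mul_comm δ ε]

theorem SignedG.adj {s : ℝ} {ε : ℂ} (hε : ε = 1 ∨ ε = -1) {x : Loop} (hx : x ∈ SignedG s ε) :
    adjLoop x ∈ SignedG s ε := by
  refine ⟨LambdaGC.adj hx.1, fun z => ?_⟩
  rw [adjLoop, rhoMat_adjugate, hx.2, adjugate_adjugate_two]
  rcases hε with rfl | rfl
  · rw [one_smul, one_smul, adjugate_adjugate_two]
  · rw [neg_one_smul, neg_one_smul, adjugate_neg_two, adjugate_adjugate_two]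

theorem mem_lambdaGTau_iff {s : ℝ} {x : Loop} : x ∈ LambdaGTau s ↔ x ∈ SignedG s 1 := by
  refine and_congr_right fun hx => ?_
  rw [funext_iff]
  refine forall_congr' fun z => ?_
  rw [one_smul, ← tau_eq_iff (hx.2 z)]
  rfl

theorem const_sigma1_mem (s : ℝ) : (fun _ => I • sigma1 : Loop) ∈ SignedG s (-1) := by
  have e : I • sigma1 = !![0, I; I, 0] := by
    ext i j
    fin_cases i <;> fin_cases j <;> simp [sigma1]
  refine ⟨⟨isHs_const s _, fun z => ?_⟩, fun z => ?_⟩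
  · simp [e, Matrix.det_fin_two]
  · dsimp only
    rw [e, rhoMat_apply, Matrix.adjugate_fin_two_of]
    ext i j
    fin_cases i <;> fin_cases j <;> simp

/-- The constant iσ₁ has sign -1, so multiplying by it or its inverse exchanges the two components.
-/
theorem mem_sigma1LambdaGTau_iff {s : ℝ} (hs : 1 / 2 < s) {x : Loop} :
    x ∈ sigma1LambdaGTau s ↔ x ∈ SignedG s (-1) := by
  have hc := const_sigma1_mem s
  constructor
  · rintro ⟨y, hy, rfl⟩
    rw [mem_lambdaGTau_iff] at hy
    have := SignedG.mul hs hc hy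
    rwa [mul_one] at this
  · intro hx
    refine ⟨adjLoop (fun _ => I • sigma1) * x, ?_, ?_⟩
    · rw [mem_lambdaGTau_iff]
      have := SignedG.mul hs (SignedG.adj (Or.inr rfl) hc) hx
      rwa [neg_mul_neg, one_mul] at this
    · funext z
      have := mul_adjugate_of_det (hc.1.2 z)
      simp only [Pi.mul_apply, adjLoop]
      rw [← mul_assoc, this, one_mul]

/-- The two sign conditions are closed and cover the connected circle. They cannot meet, since adj g
= -adj g is impossible for determinant 1. -/
theorem mem_lambdaG_iff {s : ℝ} (hs : 1 / 2 < s) {x : Loop} :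
    x ∈ LambdaG s ↔ x ∈ SignedG s 1 ∨ x ∈ SignedG s (-1) := by
  have h0 : ∀ {z}, (x z).det = 1 →
      (x z ∈ G ↔ rhoMat (x z) = (x z).adjugate ∨ rhoMat (x z) = -(x z).adjugate) := by
    intro z hz
    rw [← tau_eq_iff hz, ← tau_eq_neg_iff hz]
    exact ⟨fun h => h.2, fun h => ⟨hz, h⟩⟩
  constructor
  · rintro ⟨hx, hG⟩
    have hc1 : Continuous fun z => rhoMat (x z) := (rhoLoop_eq hs hx.1).1.1
    have hc2 : Continuous fun z => (x z).adjugate := (adjLoop_eq hx.1).1.1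
    have hpre : IsPreconnected (Set.univ : Set Circle) := by
      have h := isPreconnected_range (f := Circle.exp) Circle.exp.continuous
      rwa [Set.range_eq_univ.2 Circle.exp_surjective] at h
    have key := isPreconnected_closed_iff.1 hpre {z | rhoMat (x z) = (x z).adjugate}
      {z | rhoMat (x z) = -(x z).adjugate} (isClosed_eq hc1 hc2) (isClosed_eq hc1 hc2.neg)
      fun z _ => (h0 (hx.2 z)).1 (hG z)
    by_cases h1 : ∃ z, rhoMat (x z) = (x z).adjugate
    · by_cases h2 : ∃ z, rhoMat (x z) = -(x z).adjugate
      · obtain ⟨z1, hz1⟩ := h1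
        obtain ⟨z2, hz2⟩ := h2
        obtain ⟨z, -, hz, hz'⟩ := key ⟨z1, trivial, hz1⟩ ⟨z2, trivial, hz2⟩
        have h3 : (x z).adjugate = -(x z).adjugate := (Set.mem_ofPred.1 hz).symm.trans hz'
        have h4 : (x z).adjugate = 0 := by
          ext i j
          have := congrFun (congrFun h3 i) j
          exact self_eq_neg.1 this
        have h5 := det_adjugate_two (g := x z)
        rw [h4, hx.2] at h5
        simp at h5
      · refine Or.inl ⟨hx, fun z => ?_⟩
        rw [one_smul]
        exact ((h0 (hx.2 z)).1 (hG z)).resolve_right fun h => h2 ⟨z, h⟩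
    · refine Or.inr ⟨hx, fun z => ?_⟩
      rw [neg_one_smul]
      exact ((h0 (hx.2 z)).1 (hG z)).resolve_left fun h => h1 ⟨z, h⟩
  · rintro (h | h)
    · refine ⟨h.1, fun z => (h0 (h.1.2 z)).2 (Or.inl ?_)⟩
      rw [h.2, one_smul]
    · refine ⟨h.1, fun z => (h0 (h.1.2 z)).2 (Or.inr ?_)⟩
      rw [h.2, neg_one_smul]

theorem mem_lambdaG_iff_exists {s : ℝ} (hs : 1 / 2 < s) {x : Loop} :
    x ∈ LambdaG s ↔ ∃ ε : ℂ, (ε = 1 ∨ ε = -1) ∧ x ∈ SignedG s ε := by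
  rw [mem_lambdaG_iff hs]
  constructor
  · rintro (h | h)
    exacts [⟨1, Or.inl rfl, h⟩, ⟨-1, Or.inr rfl, h⟩]
  · rintro ⟨ε, rfl | rfl, h⟩
    exacts [Or.inl h, Or.inr h]

/-! ### Triangular matrices with positive diagonal -/

theorem mem_triReal_iff {m : M2} :
    m ∈ TriReal ↔ ∃ (a d : ℝ) (b : ℂ), 0 < a ∧ 0 < d ∧ m = !![(a : ℂ), b; 0, (d : ℂ)] := by
  constructor
  · rintro ⟨h, ⟨h1, h2⟩, ⟨h3, h4⟩⟩
    refine ⟨_, _, m 0 1, h1, h3, ?_⟩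
    conv_lhs => rw [Matrix.eta_fin_two m, h]
    congr
    · exact Complex.ext (by simp) (by simp [h2])
    · exact Complex.ext (by simp) (by simp [h4])
  · rintro ⟨a, d, b, ha, hd, rfl⟩
    simp [TriReal, ha, hd]

theorem TriReal.mul {m m' : M2} (h : m ∈ TriReal) (h' : m' ∈ TriReal) : m * m' ∈ TriReal := by
  rw [mem_triReal_iff] at *
  obtain ⟨a, d, b, ha, hd, rfl⟩ := h
  obtain ⟨a', d', b', ha', hd', rfl⟩ := h'
  refine ⟨a * a', d * d', a * b' + b * d', mul_pos ha ha', mul_pos hd hd', ?_⟩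
  simp

theorem TriReal.adj {m : M2} (h : m ∈ TriReal) : m.adjugate ∈ TriReal := by
  rw [mem_triReal_iff] at *
  obtain ⟨a, d, b, ha, hd, rfl⟩ := h
  refine ⟨d, a, -b, hd, ha, ?_⟩
  simp [Matrix.adjugate_fin_two_of]

/-- Here ρ gives a lower triangular matrix and the adjugate an upper triangular one, so the
off-diagonal entry vanishes. The diagonal satisfies a = δd, so positivity excludes δ = -1, and ad =
1 finishes. -/
theorem TriReal.eq_one {m : M2} {δ : ℂ} (hδ : δ = 1 ∨ δ = -1) (h : m ∈ TriReal)
    (hdet : m.det = 1) (hr : rhoMat m = δ • m.adjugate) : m = 1 := by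
  obtain ⟨a, d, b, ha, hd, rfl⟩ := mem_triReal_iff.1 h
  rw [rhoMat_apply, Matrix.adjugate_fin_two_of] at hr
  have h00 := congrFun (congrFun hr 0) 0
  have h01 := congrFun (congrFun hr 0) 1
  rw [Matrix.det_fin_two_of, mul_zero, sub_zero] at hdet
  norm_cast at hdet
  simp at h00 h01
  have hb : b = 0 := by
    rcases h01 with h | h
    · rcases hδ with rfl | rfl <;> norm_num at h
    · exact h
  have had : a = d := by
    rcases hδ with rfl | rfl
    · rw [one_mul] at h00
      exact_mod_cast h00
    · have : a = -d := by
        rw [neg_one_mul] at h00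
        exact_mod_cast h00
      linarith
  subst had
  have ha1 : a = 1 := by nlinarith
  rw [hb, ha1, Matrix.one_fin_two]
  norm_num

/-! ### Existence and uniqueness of the normalized factorization -/

theorem IsNormalizedIwasawa.eq_mul_adj {s : ℝ} {X F B : Loop} (h : IsNormalizedIwasawa s X F B) :
    F = X * adjLoop B := by
  rw [h.2.2, mul_assoc, mul_adjLoop h.2.1.1.2, mul_one]

/-- The quotient C = B'B⁻¹ = F'⁻¹F is plus as a quotient of the B's and satisfies ρC = ±C⁻¹ as a
quotient of the F's. So it is also minus, hence constant, and `TriReal.eq_one` applies. -/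
theorem IsNormalizedIwasawa.unique {s : ℝ} (hs : 1 / 2 < s) {X F B F' B' : Loop}
    (h : IsNormalizedIwasawa s X F B) (h' : IsNormalizedIwasawa s X F' B') :
    F = F' ∧ B = B' := by
  obtain ⟨ε, hε, hF⟩ := (mem_lambdaG_iff_exists hs).1 h.1
  obtain ⟨ε', hε', hF'⟩ := (mem_lambdaG_iff_exists hs).1 h'.1
  obtain ⟨hB, hBp, hB0⟩ := (mem_lambdaPlusReal_iff hs).1 h.2.1
  obtain ⟨hB', hBp', hB0'⟩ := (mem_lambdaPlusReal_iff hs).1 h'.2.1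
  set C := B' * adjLoop B with hC
  have hCF : C = adjLoop F' * F := by
    calc C = adjLoop F' * F' * B' * adjLoop B := by rw [adjLoop_mul_self hF'.1.2, one_mul]
      _ = adjLoop F' * (F' * B') * adjLoop B := by rw [mul_assoc (adjLoop F')]
      _ = adjLoop F' * F := by rw [← h'.2.2, mul_assoc, ← h.eq_mul_adj]
  have hCG : C ∈ SignedG s (ε' * ε) := by
    rw [hCF]
    exact SignedG.mul hs (SignedG.adj hε' hF') hF
  have hδ : ε' * ε = 1 ∨ ε' * ε = -1 := by
    rcases hε with rfl | rfl <;> rcases hε' with rfl | rfl <;> simp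
  obtain ⟨hCp, hC0⟩ := Plus.mul hs hB'.1 (LambdaGC.adj hB).1 hBp' (hBp.adj hB.1)
  rw [coeff_adjLoop_zero hB.1] at hC0
  have hCm : Minus C := by
    intro k hk
    have h1 := congrFun (rhoLoop_eq hs hCG.1.1).2 k
    have h2 : rhoLoop C = (ε' * ε) • adjLoop C := funext hCG.2
    rw [h2, coeff_smul, Pi.smul_apply, (adjLoop_eq hCG.1.1).2, rho_apply, hCp (-k) (by omega),
      rhoMat_zero, smul_eq_zero] at h1
    have h3 := h1.resolve_left (by rcases hδ with h | h <;> rw [h] <;> norm_num)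
    rw [← adjugate_adjugate_two (coeff C k)]
    exact (congrArg Matrix.adjugate h3).trans adjugate_zero_two
  have hconst := eq_const_of_plus_of_minus hs hCG.1.1 hCp hCm
  have h1 : coeff C 0 = 1 := by
    refine TriReal.eq_one hδ ?_ (det_coeff_zero hs hCG.1 hCp) ?_
    · rw [hC0]
      exact TriReal.mul hB0' (TriReal.adj hB0)
    · have := hCG.2 1
      rwa [congrFun hconst 1] at this
  have hC1 : C = 1 := by
    rw [hconst, h1]
    rfl
  have hBB : B = B' := by
    calc B = C * B := by rw [hC1, one_mul]
      _ = B' := by rw [hC, mul_assoc, adjLoop_mul_self hB.2, mul_one]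
  exact ⟨by rw [h.eq_mul_adj, h'.eq_mul_adj, hBB], hBB⟩

/-- ρ-invariance and determinant 1 give D = diag(d, d⁻¹) with d real. For diagonal T the product
ρ(T)T has positive diagonal, so the sign of d must be carried by ε; this sign selects the component
of F. -/
theorem exists_diagonal_normalization {D c : M2} (hD01 : D 0 1 = 0) (hD10 : D 1 0 = 0)
    (hD : rhoMat D = D) (hDdet : D.det = 1) (hc : c 1 0 = 0) (hcdet : c.det = 1) :
    ∃ (T : M2) (ε : ℂ), (ε = 1 ∨ ε = -1) ∧ T.det = 1 ∧ T * c ∈ TriReal ∧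
      rhoMat T * T = ε • D := by
  rw [Matrix.det_fin_two, hc, mul_zero, sub_zero] at hcdet
  rw [Matrix.det_fin_two, hD10, mul_zero, sub_zero] at hDdet
  have hα : c 0 0 ≠ 0 := left_ne_zero_of_mul_eq_one hcdet
  obtain ⟨d, hd⟩ : ∃ d : ℝ, D 0 0 = d := by
    have h := congrFun (congrFun hD 0) 0
    rw [rhoMat_apply] at h
    exact ⟨(D 0 0).re, (Complex.conj_eq_iff_re.1 h).symm⟩
  have hd0 : d ≠ 0 := by
    rintro rfl
    simp [hd] at hDdet
  have hD11 : D 1 1 = (d : ℂ)⁻¹ := by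
    rw [hd] at hDdet
    exact eq_inv_of_mul_eq_one_right hDdet
  have hc11 : c 1 1 = (c 0 0)⁻¹ := eq_inv_of_mul_eq_one_right hcdet
  set α := c 0 0 with hαdef
  have hn : 0 < ‖α‖ := norm_pos_iff.2 hα
  -- The modulus √|d| gives |t|² = |d|; the phase cancels that of α, making tα positive.
  set t : ℂ := Real.sqrt |d| * (star α / ‖α‖) with ht
  have hsq : 0 < Real.sqrt |d| := Real.sqrt_pos.2 (abs_pos.2 hd0)
  have hαα : star α * α = (‖α‖ : ℂ) ^ 2 := Complex.conj_mul' α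
  have hnc : (‖α‖ : ℂ) ≠ 0 := by exact_mod_cast hn.ne'
  have htα : t * α = ((Real.sqrt |d| * ‖α‖ : ℝ) : ℂ) := by
    rw [ht]
    calc _ = Real.sqrt |d| * ((star α * α) / ‖α‖) := by ring
      _ = _ := by rw [hαα]; push_cast; field_simp
  have ht0 : t ≠ 0 := by
    intro h
    rw [h, zero_mul] at htα
    have : Real.sqrt |d| * ‖α‖ = 0 := by exact_mod_cast htα.symm
    exact (mul_pos hsq hn).ne' this
  have htt : star t * t = ((|d| : ℝ) : ℂ) := by
    have h1 : ‖t‖ = Real.sqrt |d| := by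
      rw [ht, norm_mul, norm_div, norm_star, Complex.norm_real, Complex.norm_real, norm_norm,
        div_self hn.ne', mul_one, Real.norm_of_nonneg hsq.le]
    have h2 : star t * t = (‖t‖ : ℂ) ^ 2 := Complex.conj_mul' t
    rw [h2, h1, ← Complex.ofReal_pow, Real.sq_sqrt (abs_nonneg d)]
  refine ⟨!![t, 0; 0, t⁻¹], if 0 < d then 1 else -1, by split_ifs <;> simp, ?_, ?_, ?_⟩
  · simp [Matrix.det_fin_two_of, ht0]
  · rw [mem_triReal_iff]
    refine ⟨_, _, t * c 0 1, mul_pos hsq hn, inv_pos.2 (mul_pos hsq hn), ?_⟩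
    rw [Complex.ofReal_inv, ← htα, Matrix.eta_fin_two c, ← hαdef, hc, hc11]
    simp [mul_comm]
  · have h3 : star t⁻¹ * t⁻¹ = ((|d| : ℝ) : ℂ)⁻¹ := by
      rw [← htt, star_inv₀, mul_inv (star t) t]
    rw [rhoMat_apply, Matrix.eta_fin_two D, hd, hD11, hD01, hD10]
    have h4 : (if 0 < d then 1 else -1 : ℂ) * d = ((|d| : ℝ) : ℂ) ∧
        (if 0 < d then 1 else -1 : ℂ) * (d : ℂ)⁻¹ = ((|d| : ℝ) : ℂ)⁻¹ := by
      split_ifs with h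
      · rw [abs_of_pos h, one_mul, one_mul]
        exact ⟨rfl, rfl⟩
      · rw [abs_of_nonpos (not_lt.1 h), neg_one_mul, neg_one_mul]
        push_cast
        rw [inv_neg]
        exact ⟨rfl, rfl⟩
    ext i j
    fin_cases i <;> fin_cases j
    · simpa using htt.trans h4.1.symm
    · simp
    · simp
    · have := h3.trans h4.2.symm
      simpa using this

theorem loopTau_inv {x : Loop} (hx : ∀ z, (x z).det = 1) : (loopTau x)⁻¹ = rhoLoop x := by
  funext z
  have h1 : (rhoMat (x z)).det = 1 := by rw [det_rhoMat, hx, star_one]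
  rw [Pi.inv_apply, loopTau, tau_eq, Matrix.nonsing_inv_nonsing_inv _ (by simp [h1])]
  rfl

theorem exists_isNormalizedIwasawa {s : ℝ} (hs : 1 / 2 < s) {X : Loop}
    (hX : X ∈ iwasawaBigCell s) : ∃ F B, IsNormalizedIwasawa s X F B := by
  obtain ⟨hXG, b, ⟨hb, f, hbf, hf0⟩, c, hc, hbc⟩ := hX
  obtain ⟨hbm, hb0⟩ := minus_of_isMinusExtension hs hb.1 hbf
  rw [← hb0] at hf0
  obtain ⟨hc, hcp, hc0⟩ := (mem_lambdaPlusTri_iff hs).1 hc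
  rw [loopTau_inv hXG.2] at hbc
  have hbcz : ∀ z, rhoMat (X z) * X z = b z * c z := fun z => congrFun hbc z
  have hrc := LambdaGC.rho hs hc
  have hrb := LambdaGC.rho hs hb
  -- From bc = ρ(c)ρ(b), the plus loop ρ(b)c⁻¹ equals the minus loop ρ(c)⁻¹b, so E is constant.
  set E := rhoLoop b * adjLoop c with hE
  have hself : ∀ z, rhoMat (b z * c z) = b z * c z := fun z => by
    rw [← hbcz z, rhoMat_mul, rhoMat_rhoMat]
  have hE' : E = adjLoop (rhoLoop c) * b := by
    funext z
    have h1 := adjugate_mul_of_det (hrc.2 z)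
    have h2 := mul_adjugate_of_det (hc.2 z)
    calc E z = (rhoMat (c z)).adjugate * rhoMat (c z) * rhoMat (b z) * (c z).adjugate := by
          have h1' : (rhoMat (c z)).adjugate * rhoMat (c z) = 1 := h1
          rw [h1', one_mul]
          rfl
      _ = (rhoMat (c z)).adjugate * (b z * c z) * (c z).adjugate := by
          rw [← hself z, rhoMat_mul]
          simp only [mul_assoc]
      _ = (rhoMat (c z)).adjugate * b z := by
          rw [mul_assoc, mul_assoc (b z), h2, mul_one]
  have hEG : E ∈ LambdaGC s := LambdaGC.mul hs hrb (LambdaGC.adj hc)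
  obtain ⟨hEp, hE0⟩ := Plus.mul hs hrb.1 (LambdaGC.adj hc).1 (hbm.rho hs hb.1) (hcp.adj hc.1)
  obtain ⟨hEm, hE0'⟩ := Minus.mul hs (LambdaGC.adj hrc).1 hb.1 ((hcp.rho hs hc.1).adj hrc.1) hbm
  rw [← hE'] at hEm hE0'
  rw [← hE] at hEp hE0
  rw [coeff_rhoLoop_zero hs hb.1, coeff_adjLoop_zero hc.1, rhoMat_apply,
    Matrix.adjugate_fin_two] at hE0
  rw [coeff_adjLoop_zero hrc.1, coeff_rhoLoop_zero hs hc.1, rhoMat_apply,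
    Matrix.adjugate_fin_two_of, Matrix.eta_fin_two (coeff b 0)] at hE0'
  have hconst := eq_const_of_plus_of_minus hs hEG.1 hEp hEm
  have hdet := det_coeff_zero hs hEG hEp
  set D := coeff E 0 with hDdef
  have hEz : ∀ z, E z = D := fun z => congrFun hconst z
  have hDr : rhoMat D = D := by
    rw [← hEz 1]
    conv_rhs => rw [hE']
    rw [hE]
    change rhoMat (rhoMat (b 1) * (c 1).adjugate) = (rhoMat (c 1)).adjugate * b 1
    rw [rhoMat_mul, rhoMat_rhoMat, rhoMat_adjugate]
  -- The plus expression of D is a product of upper triangular matrices; the minus expression is one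
  -- of lower triangular matrices and gives the other entry.
  have hD10 : D 1 0 = 0 := by
    rw [hE0]
    simp [hf0, hc0]
  have hD01 : D 0 1 = 0 := by
    rw [hE0']
    simp [hf0, hc0]
  obtain ⟨T, ε, hε, hT, hTc, hTD⟩ := exists_diagonal_normalization hD01 hD10 hDr hdet hc0
    (det_coeff_zero hs hc hcp)
  have hbz : ∀ z, b z = rhoMat (c z) * D := fun z => by
    have h1 : rhoMat (c z) * (rhoMat (c z)).adjugate = 1 := mul_adjugate_of_det (hrc.2 z)
    rw [← hEz z, hE']
    change b z = rhoMat (c z) * ((rhoMat (c z)).adjugate * b z)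
    rw [← mul_assoc, h1, one_mul]
  have hTG : (fun _ => T : Loop) ∈ LambdaGC s := ⟨isHs_const s T, fun _ => hT⟩
  set B : Loop := (fun _ => T) * c with hB
  have hBG : B ∈ LambdaGC s := LambdaGC.mul hs hTG hc
  have hBp := Plus.mul hs hTG.1 hc.1 (fun k hk => by rw [coeff_const, if_neg hk.ne]) hcp
  rw [coeff_const, if_pos rfl] at hBp
  refine ⟨X * adjLoop B, B, (mem_lambdaG_iff_exists hs).2 ⟨ε, hε,
    LambdaGC.mul hs hXG (LambdaGC.adj hBG), fun z => ?_⟩, ?_, ?_⟩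
  -- From ρ(X)X = ρ(c)Dc one gets ρ(B)B = ε ρ(X)X, which is equivalent to ρ(F) = εF⁻¹ for F = XB⁻¹.
  · have hεε : ε * ε = 1 := by rcases hε with rfl | rfl <;> norm_num
    have h1 : rhoMat (B z) * B z = ε • (rhoMat (X z) * X z) := by
      change rhoMat (T * c z) * (T * c z) = _
      calc rhoMat (T * c z) * (T * c z) = rhoMat (c z) * (rhoMat T * T) * c z := by
            rw [rhoMat_mul]
            simp only [mul_assoc]
        _ = ε • (rhoMat (c z) * D * c z) := by rw [hTD, Matrix.mul_smul, Matrix.smul_mul]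
        _ = _ := by rw [← hbz, hbcz]
    have h2 : rhoMat (X z) = ε • (rhoMat (B z) * B z * (X z).adjugate) := by
      rw [h1, Matrix.smul_mul, smul_smul, hεε, one_smul, mul_assoc,
        mul_adjugate_of_det (hXG.2 z), mul_one]
    change rhoMat (X z * (B z).adjugate) = ε • (X z * (B z).adjugate).adjugate
    rw [rhoMat_mul, h2, Matrix.adjugate_mul_distrib, adjugate_adjugate_two, Matrix.mul_smul,
      ← mul_assoc, ← mul_assoc, ← rhoMat_mul, mul_adjugate_of_det (hBG.2 z), rhoMat_one, one_mul]
  · exact (mem_lambdaPlusReal_iff hs).2 ⟨hBG, hBp.1, hBp.2 ▸ hTc⟩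
  · rw [mul_assoc, adjLoop_mul_self hBG.2, mul_one]

/-! ### Supports of Laurent series -/

theorem mem_lam_coe {p q : ℤ} {a : ℤ → M2} :
    a ∈ Lam (p : WithBot ℤ) (q : WithTop ℤ) ↔ ∀ j, (j < p ∨ q < j) → a j = 0 := by
  refine forall_congr' fun j => ?_
  rw [WithBot.coe_le_coe, WithTop.coe_le_coe, not_and_or, not_le, not_le]

theorem mem_lamSym {n : ℕ} {a : ℤ → M2} :
    a ∈ LamSym n ↔ ∀ j, (j < -(n : ℤ) ∨ (n : ℤ) < j) → a j = 0 := mem_lam_coe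

theorem mem_lamGE {n : ℕ} {a : ℤ → M2} : a ∈ LamGE n ↔ ∀ j < -(n : ℤ), a j = 0 := by
  refine forall_congr' fun j => ?_
  rw [WithBot.coe_le_coe, not_and_or, not_le]
  simp

theorem proj_neg_eq_zero_iff {a : ℤ → M2} :
    proj ⊥ ((-1 : ℤ) : WithTop ℤ) a = 0 ↔ ∀ k < 0, a k = 0 := by
  rw [funext_iff]
  refine forall_congr' fun k => ?_
  have hiff : (⊥ ≤ (k : WithBot ℤ) ∧ (k : WithTop ℤ) ≤ ((-1 : ℤ) : WithTop ℤ)) ↔ k < 0 := by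
    rw [WithTop.coe_le_coe]
    simp only [bot_le, true_and]
    omega
  unfold proj
  by_cases hk : k < 0
  · rw [if_pos (hiff.2 hk)]
    exact ⟨fun h _ => h, fun h => h hk⟩
  · rw [if_neg fun h => hk (hiff.1 h)]
    exact ⟨fun _ h => absurd h hk, fun _ => rfl⟩

theorem bar_eq_zero_iff {a : ℤ → M2} : bar a = 0 ↔ a = 0 := by
  constructor
  · intro h
    funext k
    ext i j
    have := congrFun (congrFun (congrFun h (-k)) i) j
    simpa [bar] using this
  · rintro rfl
    funext k
    ext i j
    simp [bar]

open Classical in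
/-- A Laurent polynomial is the family of its coefficients. -/
def lamEquiv (p q : ℤ) :
    Lam (p : WithBot ℤ) (q : WithTop ℤ) ≃ₗ[ℂ] (Finset.Icc p q → M2) where
  toFun a j := a.1 j
  map_add' _ _ := rfl
  map_smul' _ _ := rfl
  invFun g := ⟨fun j => if h : j ∈ Finset.Icc p q then g ⟨j, h⟩ else 0,
    mem_lam_coe.2 fun j hj => dif_neg fun h => by
      rw [Finset.mem_Icc] at h
      omega⟩
  left_inv a := by
    ext1
    funext j
    by_cases h : j ∈ Finset.Icc p q
    · exact dif_pos h
    · refine (dif_neg h).trans (mem_lam_coe.1 a.2 j ?_).symm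
      rw [Finset.mem_Icc] at h
      omega
  right_inv g := by
    funext j
    exact dif_pos j.2

/-! ### Dimensions and range of the linear system -/

theorem finrank_lam (p q : ℤ) :
    Module.finrank ℂ (Lam (p : WithBot ℤ) (q : WithTop ℤ)) = (q + 1 - p).toNat * 4 := by
  rw [(lamEquiv p q).finrank_eq, Module.finrank_pi_fintype]
  simp [Module.finrank_matrix]

theorem finrank_lamSym (n : ℕ) : Module.finrank ℂ (LamSym n) = 8 * n + 4 := by
  rw [LamSym, finrank_lam]
  omega

/-- The product of two submodules, as a module. -/
def submoduleProdEquiv {M N : Type*} [AddCommGroup M] [AddCommGroup N] [Module ℂ M] [Module ℂ N]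
    (p : Submodule ℂ M) (q : Submodule ℂ N) : p.prod q ≃ₗ[ℂ] p × q where
  toFun a := (⟨a.1.1, a.2.1⟩, ⟨a.1.2, a.2.2⟩)
  map_add' _ _ := rfl
  map_smul' _ _ := rfl
  invFun a := ⟨(a.1.1, a.2.1), a.1.2, a.2.2⟩
  left_inv _ := rfl
  right_inv _ := rfl

theorem finrank_targetSpace (n : ℕ) : Module.finrank ℂ (targetSpace n) = 16 * n + 4 := by
  have hfin : ∀ p q : ℤ, Module.Finite ℂ (Lam (p : WithBot ℤ) (q : WithTop ℤ)) := fun p q =>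
    Module.Finite.equiv (lamEquiv p q).symm
  have h1 := hfin (-(2 * n : ℤ)) (-1)
  have h2 := hfin 1 (2 * n)
  have h3 := Module.Finite.equiv (submoduleProdEquiv
    (Lam ((1 : ℤ) : WithBot ℤ) ((2 * n : ℤ) : WithTop ℤ)) (⊤ : Submodule ℂ (Fin 4 → ℂ))).symm
  rw [targetSpace, (submoduleProdEquiv _ _).finrank_eq, Module.finrank_prod,
    (submoduleProdEquiv _ _).finrank_eq, Module.finrank_prod, finrank_lam, finrank_lam,
    finrank_top, Module.finrank_fin_fun]
  omega

theorem range_iwasawaLin_le {n : ℕ} {X : ℤ → M2} (hX : X ∈ LamGE n) :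
    LinearMap.range (iwasawaLin n X) ≤ targetSpace n := by
  have h0 : ∀ a ∈ LamSym n, ∀ k < -(2 * n : ℤ), conv a X k = 0 := by
    intro a ha k hk
    exact (conv_of_ge (fun j hj => mem_lamSym.1 ha j (Or.inl hj)) (mem_lamGE.1 hX)).1 k (by omega)
  have h1 : ∀ a ∈ LamSym n, proj ⊥ ((-1 : ℤ) : WithTop ℤ) (conv a X) ∈
      Lam ((-(2 * n : ℤ) : ℤ) : WithBot ℤ) ((-1 : ℤ) : WithTop ℤ) := by
    intro a ha
    rw [mem_lam_coe]
    rintro j (hj | hj)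
    · simp [proj, h0 a ha j hj]
    · unfold proj
      rw [if_neg]
      rintro ⟨-, h⟩
      rw [WithTop.coe_le_coe] at h
      omega
  rintro _ ⟨W, rfl⟩
  refine ⟨h1 _ W.2, ?_, trivial⟩
  have h2 := mem_lam_coe.1 (h1 _ (adj_rho_mem W.2))
  refine mem_lam_coe.2 fun j hj => ?_
  change Matrix.map (proj _ _ _ (-j)) star = 0
  rw [h2 (-j) (by omega)]
  ext i j
  simp

theorem adj_eq_zero_iff {m : M2} : m.adjugate = 0 ↔ m = 0 := by
  constructor
  · intro h
    rw [← adjugate_adjugate_two m, h, adjugate_zero_two]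
  · rintro rfl
    exact adjugate_zero_two

theorem adj_mem_lamSym {n : ℕ} {a : ℤ → M2} (ha : a ∈ LamSym n) : adj a ∈ LamSym n :=
  mem_lamSym.2 fun j hj => by rw [adj, mem_lamSym.1 ha j hj, adjugate_zero_two]

/-- The data of a normalized factorization in terms of Fourier coefficients. -/
theorem IsNormalizedIwasawa.data {s : ℝ} (hs : 1 / 2 < s) {X F B : Loop}
    (h : IsNormalizedIwasawa s X F B) :
    (∃ ε : ℂ, (ε = 1 ∨ ε = -1) ∧ F ∈ SignedG s ε) ∧ B ∈ LambdaGC s ∧ Plus B ∧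
      coeff B 0 ∈ TriReal ∧ X ∈ LambdaGC s := by
  have hF := (mem_lambdaG_iff_exists hs).1 h.1
  obtain ⟨hB, hBp, hB0⟩ := (mem_lambdaPlusReal_iff hs).1 h.2.1
  exact ⟨hF, hB, hBp, hB0, h.2.2 ▸ LambdaGC.mul hs h.1.1 hB⟩

/-- Multiplying by B or B⁻¹ on the right does not lower the bottom degree, so X and F share the
lower bound -n. The upper bound is automatic: ρF = εF⁻¹ pairs the coefficients of F of index j and
-j. -/
theorem coeff_mem_lamSym_iff {s : ℝ} (hs : 1 / 2 < s) {X F B : Loop}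
    (h : IsNormalizedIwasawa s X F B) (n : ℕ) : coeff F ∈ LamSym n ↔ coeff X ∈ LamGE n := by
  obtain ⟨⟨ε, hε, hF⟩, hB, hBp, hB0, hX⟩ := h.data hs
  constructor
  · intro hn
    have := (conv_of_ge (fun j hj => mem_lamSym.1 hn j (Or.inl hj)) hBp).1
    rw [← coeff_mul hs hF.1.1 hB.1, ← h.2.2, add_zero] at this
    exact mem_lamGE.2 this
  · intro hn
    have hlow := (conv_of_ge (mem_lamGE.1 hn) (hBp.adj hB.1)).1
    rw [← coeff_mul hs hX.1 (LambdaGC.adj hB).1, ← h.eq_mul_adj, add_zero] at hlow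
    refine mem_lamSym.2 fun j hj => ?_
    rcases hj with hj | hj
    · exact hlow j hj
    · have h1 := congrFun (rhoLoop_eq hs hF.1.1).2 j
      have h2 : rhoLoop F = ε • adjLoop F := funext hF.2
      rw [h2, coeff_smul, Pi.smul_apply, (adjLoop_eq hF.1.1).2, rho_apply, hlow (-j) (by omega),
        rhoMat_zero, smul_eq_zero] at h1
      exact adj_eq_zero_iff.1 (h1.resolve_left (by rcases hε with h | h <;> rw [h] <;> norm_num))

theorem coeff_bottom {s : ℝ} (hs : 1 / 2 < s) {X F B : Loop}
    (h : IsNormalizedIwasawa s X F B) {n : ℕ} (hn : coeff F ∈ LamSym n) :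
    coeff X (-n) = coeff F (-n) * coeff B 0 := by
  obtain ⟨⟨ε, hε, hF⟩, hB, hBp, hB0, hX⟩ := h.data hs
  have := (conv_of_ge (fun j hj => mem_lamSym.1 hn j (Or.inl hj)) hBp).2
  rwa [← coeff_mul hs hF.1.1 hB.1, ← h.2.2, add_zero] at this

/-! ### Laurent polynomial loops -/

/-- Passes from finite coefficient sequences to genuine loops, so that statements about loops apply
to elements of Λ_{-n,n}. -/
theorem laurentLoop_eq {n : ℕ} {W : ℤ → M2} (hW : W ∈ LamSym n) (s : ℝ) :
    IsHs s (laurentLoop n W) ∧ coeff (laurentLoop n W) = W := by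
  have hfin : ∀ i j, (Function.support fun k => W k i j) ⊆ Finset.Icc (-(n : ℤ)) n := by
    intro i j k hk
    rw [Finset.mem_coe, Finset.mem_Icc]
    by_contra h
    refine hk ?_
    change W k i j = 0
    rw [mem_lamSym.1 hW k (by omega), Matrix.zero_apply]
  have hent : ∀ i j z, laurentLoop n W z i j =
      ∑ k ∈ Finset.Icc (-(n : ℤ)) n, W k i j * (z : ℂ) ^ k := by
    intro i j z
    simp [laurentLoop, Matrix.sum_apply, mul_comm]
  have hfc : ∀ i j, fc (fun z => laurentLoop n W z i j) = fun k => W k i j := by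
    intro i j
    refine fc_of_hasSum ?_ fun z => ?_
    · refine summable_of_ne_finset_zero (s := Finset.Icc (-(n : ℤ)) n) fun k hk => ?_
      by_contra h
      exact hk (hfin i j fun h0 => h (by rw [show W k i j = 0 from h0, norm_zero]))
    · rw [hent]
      refine hasSum_sum_of_ne_finset_zero fun k hk => ?_
      by_contra h
      exact hk (hfin i j fun h0 => h (by
        rw [show W k i j = 0 from h0, zero_mul]))
  refine ⟨isHs_iff.2 fun i j => memHs_of_finite ?_ ?_, ?_⟩
  · simp only [hent]
    refine continuous_finsetSum _ fun k _ => continuous_const.mul (continuous_circle_zpow k)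
  · rw [hfc]
    exact (Finset.finite_toSet _).subset (hfin i j)
  · funext k
    ext i j
    exact congrFun (hfc i j) k

/-! ### The kernel of the linear system -/

theorem adj_rho_mat (m : M2) : (rhoMat m).adjugate =
    !![star (m 1 1), star (m 1 0); star (m 0 1), star (m 0 0)] := by
  rw [rhoMat_apply, Matrix.adjugate_fin_two_of]
  simp

theorem iwasawaMap_eq_zero_iff {X W : ℤ → M2} : iwasawaMap X W = 0 ↔
    (∀ k < 0, conv W X k = 0) ∧ (∀ k < 0, conv (adj (rho W)) X k = 0) ∧
      (conv W X 0 0 0 = star (conv (adj (rho W)) X 0 0 0) ∧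
        conv W X 0 1 1 = star (conv (adj (rho W)) X 0 1 1) ∧
        conv W X 0 1 0 = 0 ∧ conv (adj (rho W)) X 0 1 0 = 0) := by
  rw [iwasawaMap, Prod.mk_eq_zero, Prod.mk_eq_zero, bar_eq_zero_iff, proj_neg_eq_zero_iff,
    proj_neg_eq_zero_iff]
  refine and_congr_right fun _ => and_congr_right fun _ => ?_
  rw [funext_iff, Fin.forall_fin_succ, Fin.forall_fin_succ, Fin.forall_fin_two]
  simp [sub_eq_zero]

/-- The two lower left equations kill the off-diagonal entries of M, because b is upper triangular
with nonzero diagonal. The (1,1) equation relates the diagonal entries by ε; the (2,2) equation is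
then redundant. -/
theorem corner_equations {ε : ℂ} (hε : ε = 1 ∨ ε = -1) {b M : M2} (hb : b ∈ TriReal) :
    ((M * b) 0 0 = star ((ε • ((rhoMat M).adjugate * b)) 0 0) ∧
      (M * b) 1 1 = star ((ε • ((rhoMat M).adjugate * b)) 1 1) ∧
      (M * b) 1 0 = 0 ∧ (ε • ((rhoMat M).adjugate * b)) 1 0 = 0) ↔
      ∃ c : ℂ, M = !![c, 0; 0, ε * c] := by
  obtain ⟨p, d, q, hp, hd, rfl⟩ := mem_triReal_iff.1 hb
  have hp' : (p : ℂ) ≠ 0 := by exact_mod_cast hp.ne'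
  have hd' : (d : ℂ) ≠ 0 := by exact_mod_cast hd.ne'
  have hεs : (starRingEnd ℂ) ε = ε := by rcases hε with rfl | rfl <;> simp
  have hε0 : ε ≠ 0 := by rcases hε with rfl | rfl <;> norm_num
  have hεε : ε * ε = 1 := by rcases hε with rfl | rfl <;> norm_num
  rw [adj_rho_mat]
  constructor
  · rintro ⟨h1, -, h3, h4⟩
    simp [Matrix.mul_apply, hεs, hp', hε0] at h1 h3 h4
    refine ⟨M 0 0, ?_⟩
    rw [Matrix.eta_fin_two M, h3, h4]
    have h5 : M 0 0 = ε * M 1 1 := mul_right_cancel₀ hp' (by rw [h1]; ring)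
    have h6 : M 1 1 = ε * M 0 0 := by rw [h5, ← mul_assoc, hεε, one_mul]
    simp [h6]
  · rintro ⟨c, rfl⟩
    simp [Matrix.mul_apply, hεs]
    exact ⟨by linear_combination (-c * p) * hεε, by ring⟩

/-- With U = WF and θ = adj ∘ ρ, the products become WX = UB and θ(W)X = εθ(U)B. Right
multiplication by B⁻¹ removes B from the plus conditions, and `corner_equations` determines the
constant U. -/
theorem iwasawaMap_coeff_eq_zero_iff {s : ℝ} (hs : 1 / 2 < s) {X F B : Loop}
    (h : IsNormalizedIwasawa s X F B) {ε : ℂ} (hε : ε = 1 ∨ ε = -1) (hF : F ∈ SignedG s ε)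
    {W : Loop} (hW : IsHs s W) : iwasawaMap (coeff X) (coeff W) = 0 ↔
      ∃ c : ℂ, W = fun z => !![c, 0; 0, ε * c] * (F z).adjugate := by
  obtain ⟨-, hB, hBp, hB0, hX⟩ := h.data hs
  have hεε : ε * ε = 1 := by rcases hε with rfl | rfl <;> norm_num
  have hθF : ∀ z, (rhoMat (F z)).adjugate = ε • F z := by
    intro z
    rw [hF.2]
    rcases hε with rfl | rfl
    · rw [one_smul, one_smul, adjugate_adjugate_two]
    · rw [neg_one_smul, neg_one_smul, adjugate_neg_two, adjugate_adjugate_two]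
  set U : Loop := W * F with hU
  have hUs : IsHs s U := hW.mul hs hF.1.1
  have hrW := rhoLoop_eq hs hW
  have hθW := adjLoop_eq hrW.1
  have hrU := rhoLoop_eq hs hUs
  have hθU := adjLoop_eq hrU.1
  set W' : Loop := adjLoop (rhoLoop W) with hW'
  set U' : Loop := adjLoop (rhoLoop U) with hU'
  have hθ : ∀ z, U' z = ε • (W' z * F z) := by
    intro z
    change (rhoMat (W z * F z)).adjugate = ε • ((rhoMat (W z)).adjugate * F z)
    rw [rhoMat_mul, Matrix.adjugate_mul_distrib, hθF, Matrix.mul_smul]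
  have hV : W * X = U * B := by rw [hU, mul_assoc, ← h.2.2]
  have hV' : W' * X = ε • (U' * B) := by
    funext z
    change W' z * X z = ε • (U' z * B z)
    rw [hθ, Matrix.smul_mul, smul_smul, hεε, one_smul, mul_assoc, h.2.2]
    rfl
  have e1 : conv (coeff W) (coeff X) = coeff (U * B) := by rw [← hV, coeff_mul hs hW hX.1]
  have e2 : conv (adj (rho (coeff W))) (coeff X) = coeff (ε • (U' * B)) := by
    rw [← hV', coeff_mul hs hθW.1 hX.1, hθW.2, hrW.2]
  have hUB : U * B * adjLoop B = U := by rw [mul_assoc, mul_adjLoop hB.2, mul_one]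
  have hUB' : U' * B * adjLoop B = U' := by rw [mul_assoc, mul_adjLoop hB.2, mul_one]
  have hWU : W = U * adjLoop F := by rw [hU, mul_assoc, mul_adjLoop hF.1.2, mul_one]
  rw [iwasawaMap_eq_zero_iff, e1, e2]
  constructor
  · rintro ⟨hp, hp', hc⟩
    have hUp : Plus U := by
      have := (Plus.mul hs (hUs.mul hs hB.1) (LambdaGC.adj hB).1 hp (hBp.adj hB.1)).1
      rwa [hUB] at this
    have hUp' : Plus U' := by
      have h1 : Plus (U' * B) := by
        intro k hk
        have h2 := hp' k hk
        rw [coeff_smul, Pi.smul_apply, smul_eq_zero] at h2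
        exact h2.resolve_left fun h => by rw [h] at hεε; simp at hεε
      have := (Plus.mul hs (hθU.1.mul hs hB.1) (LambdaGC.adj hB).1 h1 (hBp.adj hB.1)).1
      rwa [hUB'] at this
    -- θ reverses degrees, so θ(U) being plus means that U is minus.
    have hUm : Minus U := by
      intro k hk
      have h1 := hUp' (-k) (by omega)
      rw [hθU.2, hrU.2, adj, adj_eq_zero_iff, rho_apply, neg_neg] at h1
      rw [← rhoMat_rhoMat (coeff U k), h1, rhoMat_zero]
    have hconst := eq_const_of_plus_of_minus hs hUs hUp hUm
    rw [coeff_smul, Pi.smul_apply, (Plus.mul hs hUs hB.1 hUp hBp).2,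
      (Plus.mul hs hθU.1 hB.1 hUp' hBp).2, hθU.2, hrU.2, adj, rho_apply, neg_zero,
      corner_equations hε hB0] at hc
    obtain ⟨c, hc⟩ := hc
    refine ⟨c, ?_⟩
    rw [hWU, hconst, hc]
    rfl
  · rintro ⟨c, hc⟩
    have hconst : U = fun _ => !![c, 0; 0, ε * c] := by
      funext z
      rw [hU, hc]
      change !![c, 0; 0, ε * c] * (F z).adjugate * F z = _
      rw [mul_assoc, adjugate_mul_of_det (hF.1.2 z), mul_one]
    have hU0 : coeff U 0 = !![c, 0; 0, ε * c] := by rw [hconst, coeff_const, if_pos rfl]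
    have hUp : Plus U := fun k hk => by rw [hconst, coeff_const, if_neg hk.ne]
    have hUp' : Plus U' := fun k hk => by
      rw [hθU.2, hrU.2, adj, adj_eq_zero_iff, rho_apply, hconst, coeff_const,
        if_neg (by omega), rhoMat_zero]
    obtain ⟨hp, hp0⟩ := Plus.mul hs hUs hB.1 hUp hBp
    obtain ⟨hp', hp0'⟩ := Plus.mul hs hθU.1 hB.1 hUp' hBp
    refine ⟨hp, fun k hk => ?_, ?_⟩
    · rw [coeff_smul, Pi.smul_apply, hp' k hk, smul_zero]
    · rw [coeff_smul, Pi.smul_apply, hp0, hp0', hθU.2, hrU.2, adj, rho_apply, neg_zero,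
        corner_equations hε hB0]
      exact ⟨c, hU0⟩

theorem map_ker_eq_span {s : ℝ} {X K : Loop} {n : ℕ} (hK : IsHs s K)
    (hKn : coeff K ∈ LamSym n)
    (h : ∀ W : Loop, IsHs s W → (iwasawaMap (coeff X) (coeff W) = 0 ↔ ∃ c : ℂ, W = c • K)) :
    (LinearMap.ker (iwasawaLin n (coeff X))).map (LamSym n).subtype
      = Submodule.span ℂ {coeff K} := by
  ext W
  rw [Submodule.mem_span_singleton]
  constructor
  · rintro ⟨V, hV, rfl⟩
    obtain ⟨h1, h2⟩ := laurentLoop_eq V.2 s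
    obtain ⟨c, hc⟩ := (h _ h1).1 (by rw [h2]; exact hV)
    refine ⟨c, ?_⟩
    rw [← coeff_smul, ← hc, h2]
    rfl
  · rintro ⟨c, rfl⟩
    refine ⟨⟨c • coeff K, (LamSym n).smul_mem c hKn⟩, ?_, rfl⟩
    change iwasawaMap (coeff X) (c • coeff K) = 0
    rw [← coeff_smul]
    exact (h _ (hK.smul c)).2 ⟨c, rfl⟩

/-! ### Meromorphic extensions -/

theorem fc_zpow_mul (n : ℤ) (f : Circle → ℂ) (k : ℤ) :
    fc (fun z => (z : ℂ) ^ n * f z) k = fc f (k - n) := by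
  unfold fc fourierCoeff
  refine congrArg (MeasureTheory.integral _) (funext fun t => ?_)
  change fourier (-k) t * (((AddCircle.toCircle t : Circle) : ℂ) ^ n * f (AddCircle.toCircle t)) =
    fourier (-(k - n)) t * f (AddCircle.toCircle t)
  rw [← fourier_eq_toCircle_zpow, neg_sub, sub_eq_neg_add, fourier_add, mul_assoc]

/-- The order of f at 0 is -n plus that of g, and g has order 0 exactly when g(0) ≠ 0; infinite
order is included. -/
theorem isExtension_of_eqOn {f g : ℂ → ℂ} {n : ℤ} (hg : DiffContOnCl ℂ g (ball 0 1))
    (h : Set.EqOn f (fun z => z ^ (-n) * g z) {0}ᶜ) :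
    ContinuousOn f (closedBall 0 1 \ {0}) ∧ DifferentiableOn ℂ f (ball 0 1 \ {0}) ∧
      MeromorphicAt f 0 ∧ ((-n : ℤ) : WithTop ℤ) ≤ meromorphicOrderAt f 0 ∧
      (meromorphicOrderAt f 0 = ((-n : ℤ) : WithTop ℤ) ↔ g 0 ≠ 0) := by
  have hgan : AnalyticAt ℂ g 0 :=
    hg.differentiableOn.analyticAt (ball_mem_nhds 0 one_pos)
  have hid : MeromorphicAt (id : ℂ → ℂ) 0 := analyticAt_id.meromorphicAt
  have hev : f =ᶠ[nhdsWithin 0 {0}ᶜ] (id ^ (-n) * g) := by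
    filter_upwards [self_mem_nhdsWithin] with z hz
    exact h hz
  have hord : meromorphicOrderAt f 0 = ((-n : ℤ) : WithTop ℤ) + meromorphicOrderAt g 0 := by
    rw [meromorphicOrderAt_congr hev, meromorphicOrderAt_mul (hid.zpow _) hgan.meromorphicAt,
      meromorphicOrderAt_zpow hid, meromorphicOrderAt_id, mul_one]
  have h0 := hgan.meromorphicOrderAt_nonneg
  have h1 := hgan.meromorphicNFAt.meromorphicOrderAt_eq_zero_iff
  have hsub1 : closedBall (0 : ℂ) 1 \ {0} ⊆ {0}ᶜ := fun z hz => hz.2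
  have hsub2 : ball (0 : ℂ) 1 \ {0} ⊆ {0}ᶜ := fun z hz => hz.2
  refine ⟨?_, ?_, ((hid.zpow _).mul hgan.meromorphicAt).congr hev.symm, ?_, ?_⟩
  · refine ContinuousOn.congr (ContinuousOn.mul ?_ ?_) (h.mono hsub1)
    · exact fun z hz => (continuousAt_zpow₀ z _ (Or.inl hz.2)).continuousWithinAt
    · exact hg.continuousOn_ball.mono Set.sdiff_subset
  · refine DifferentiableOn.congr (DifferentiableOn.mul ?_ ?_) (h.mono hsub2)
    · exact fun z hz => (differentiableAt_zpow.2 (Or.inl hz.2)).differentiableWithinAt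
    · exact hg.differentiableOn.mono Set.sdiff_subset
  · rw [hord]
    exact le_add_of_nonneg_right h0
  · rw [hord, ← h1]
    cases meromorphicOrderAt g 0 with
    | top => exact iff_of_false (by rw [add_top]; exact WithTop.top_ne_coe) WithTop.top_ne_zero
    | coe m => norm_cast; simp

theorem exists_meromorphic_extension {x : Circle → ℂ} (hx : Continuous x)
    (hs : Summable fun k => ‖fc x k‖) {n : ℤ} (h0 : ∀ k < -n, fc x k = 0) :
    ∃ f : ℂ → ℂ, (ContinuousOn f (closedBall 0 1 \ {0}) ∧
      DifferentiableOn ℂ f (ball 0 1 \ {0}) ∧ MeromorphicAt f 0) ∧ (∀ z : Circle, f z = x z) ∧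
      ((-n : ℤ) : WithTop ℤ) ≤ meromorphicOrderAt f 0 ∧
      (meromorphicOrderAt f 0 = ((-n : ℤ) : WithTop ℤ) ↔ fc x (-n) ≠ 0) := by
  obtain ⟨g, hg, hgx, hg0⟩ := exists_extension (x := fun z => (z : ℂ) ^ n * x z)
    ((continuous_circle_zpow n).mul hx)
    (by
      simp only [fc_zpow_mul]
      exact hs.comp_injective (sub_left_injective (b := n)))
    fun k hk => by rw [fc_zpow_mul, h0 _ (by omega)]
  rw [fc_zpow_mul, zero_sub] at hg0
  obtain ⟨h1, h2, h3, h4, h5⟩ := isExtension_of_eqOn (n := n) hg fun z _ => rfl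
  rw [hg0] at h5
  refine ⟨_, ⟨h1, h2, h3⟩, fun z => ?_, h4, h5⟩
  rw [hgx, ← mul_assoc, ← zpow_add₀ (Circle.coe_ne_zero z), neg_add_cancel, zpow_zero, one_mul]

/-- The function z^n f has nonnegative order at 0, so its singularity is removable and the
holomorphic case applies after an index shift by n. -/
theorem fc_of_meromorphic_extension {x : Circle → ℂ} {f : ℂ → ℂ}
    (hc : ContinuousOn f (closedBall 0 1 \ {0})) (hd : DifferentiableOn ℂ f (ball 0 1 \ {0}))
    (hm : MeromorphicAt f 0) (hfx : ∀ z : Circle, f z = x z) {n : ℤ}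
    (hn : ((-n : ℤ) : WithTop ℤ) ≤ meromorphicOrderAt f 0) :
    (∀ k < -n, fc x k = 0) ∧
      (meromorphicOrderAt f 0 = ((-n : ℤ) : WithTop ℤ) ↔ fc x (-n) ≠ 0) := by
  have hid : MeromorphicAt (id : ℂ → ℂ) 0 := analyticAt_id.meromorphicAt
  set h : ℂ → ℂ := id ^ n * f with hh
  have hhm : MeromorphicAt h 0 := (hid.zpow n).mul hm
  have hho : 0 ≤ meromorphicOrderAt h 0 := by
    rw [hh, meromorphicOrderAt_mul (hid.zpow _) hm, meromorphicOrderAt_zpow hid,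
      meromorphicOrderAt_id, mul_one]
    calc (0 : WithTop ℤ) = (n : WithTop ℤ) + ((-n : ℤ) : WithTop ℤ) := by norm_cast; simp
      _ ≤ _ := by gcongr
  -- The normal form changes h only at 0, where it supplies the removable value.
  set g := toMeromorphicNFAt h 0 with hg
  have hgan : AnalyticAt ℂ g 0 :=
    hhm.meromorphicOrderAt_nonneg_iff_analyticAt_toMeromorphicNFAt.1 hho
  have heq : Set.EqOn h g {0}ᶜ := hhm.eqOn_compl_singleton_toMeromorphicNFAt
  have hgd : DiffContOnCl ℂ g (ball 0 1) := by
    have hball : ∀ z : ℂ, z ≠ 0 → z ∈ ball (0 : ℂ) 1 → DifferentiableAt ℂ g z := by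
      intro z hz hz1
      have hopen : IsOpen (ball (0 : ℂ) 1 \ {0}) := isOpen_ball.sdiff isClosed_singleton
      have hfd := hd.differentiableAt (hopen.mem_nhds ⟨hz1, hz⟩)
      have hhd : DifferentiableAt ℂ h z :=
        (differentiableAt_zpow.2 (Or.inl hz)).mul hfd
      refine hhd.congr_of_eventuallyEq ?_
      filter_upwards [isOpen_compl_singleton.mem_nhds hz] with w hw
      exact (heq hw).symm
    constructor
    · intro z hz
      by_cases h0 : z = 0
      · rw [h0]
        exact hgan.differentiableAt.differentiableWithinAt
      · exact (hball z h0 hz).differentiableWithinAt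
    · rw [closure_ball _ one_ne_zero]
      intro z hz
      by_cases h0 : z = 0
      · rw [h0]
        exact hgan.continuousAt.continuousWithinAt
      · have hhc : ContinuousWithinAt h (closedBall 0 1 \ {0}) z :=
          (continuousAt_zpow₀ z n (Or.inl h0)).continuousWithinAt.mul (hc z ⟨hz, h0⟩)
        have hgc : ContinuousWithinAt g (closedBall 0 1 \ {0}) z :=
          hhc.congr (fun w hw => (heq hw.2).symm) (heq h0).symm
        refine hgc.mono_of_mem_nhdsWithin ?_
        exact Filter.inter_mem self_mem_nhdsWithin
          (mem_nhdsWithin_of_mem_nhds (isOpen_compl_singleton.mem_nhds h0))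
  have hfg : Set.EqOn f (fun z => z ^ (-n) * g z) {0}ᶜ := by
    intro z hz
    have h1 : g z = z ^ n * f z := (heq hz).symm
    dsimp only
    rw [h1, ← mul_assoc, ← zpow_add₀ hz, neg_add_cancel, zpow_zero, one_mul]
  obtain ⟨-, -, -, -, hord⟩ := isExtension_of_eqOn hgd hfg
  obtain ⟨h1, h2⟩ := fc_of_extension (x := fun z => (z : ℂ) ^ n * x z) hgd fun z => by
    rw [← heq (Circle.coe_ne_zero z), ← hfx]
    rfl
  rw [fc_zpow_mul, zero_sub] at h2
  refine ⟨fun k hk => ?_, by rw [hord, h2]⟩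
  have := h1 (k + n) (by omega)
  rwa [fc_zpow_mul, add_sub_cancel_right] at this

/-! ### Pole order of X and degree of F -/

theorem extendsWithPoleLE_iff {s : ℝ} (hs : 1 / 2 < s) {X : Loop} (hX : IsHs s X) (n : ℕ) :
    ExtendsWithPoleLE X n ↔ coeff X ∈ LamGE n := by
  rw [mem_lamGE]
  constructor
  · rintro ⟨f, ⟨hf, hfX⟩, hn⟩ k hk
    ext i j
    exact (fc_of_meromorphic_extension (x := fun z => X z i j) (hf i j).1 (hf i j).2.1
      (hf i j).2.2 (fun z => by rw [hfX]) (hn i j)).1 k hk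
  · intro h
    rw [isHs_iff] at hX
    choose f h1 h2 h3 h4 using fun i j => exists_meromorphic_extension (hX i j).1
      ((hX i j).summable hs) (n := n) fun k hk => by
        rw [← coeff_apply, h k hk, Matrix.zero_apply]
    refine ⟨fun z => Matrix.of fun i j => f i j z, ⟨h1, fun z => ?_⟩, h3⟩
    ext i j
    exact h2 i j z

theorem extendsWithPole_iff {s : ℝ} (hs : 1 / 2 < s) {X : Loop} (hX : IsHs s X) (n : ℕ) :
    ExtendsWithPole X n ↔ coeff X ∈ LamGE n ∧ coeff X (-n) ≠ 0 := by
  have hne : coeff X (-n) ≠ 0 ↔ ∃ i j, fc (fun z => X z i j) (-n) ≠ 0 := by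
    rw [Ne, ← Matrix.ext_iff]
    push Not
    rfl
  rw [hne]
  constructor
  · rintro ⟨f, ⟨hf, hfX⟩, hn, i, j, hij⟩
    refine ⟨(extendsWithPoleLE_iff hs hX n).1 ⟨f, ⟨hf, hfX⟩, hn⟩, i, j, ?_⟩
    exact (fc_of_meromorphic_extension (x := fun z => X z i j) (hf i j).1 (hf i j).2.1
      (hf i j).2.2 (fun z => by rw [hfX]) (hn i j)).2.1 hij
  · rintro ⟨h, i, j, hij⟩
    rw [mem_lamGE] at h
    rw [isHs_iff] at hX
    choose f h1 h2 h3 h4 using fun i j => exists_meromorphic_extension (hX i j).1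
      ((hX i j).summable hs) (n := n) fun k hk => by
        rw [← coeff_apply, h k hk, Matrix.zero_apply]
    refine ⟨fun z => Matrix.of fun i j => f i j z, ⟨h1, fun z => ?_⟩, h3, i, j, ?_⟩
    · ext i j
      exact h2 i j z
    · exact (h4 i j).2 hij

theorem minimal_degree_iff {s : ℝ} (hs : 1 / 2 < s) {X F B : Loop}
    (h : IsNormalizedIwasawa s X F B) (n : ℕ) :
    (coeff F ∈ LamSym n ∧ ∀ m < n, coeff F ∉ LamSym m) ↔
      coeff X ∈ LamGE n ∧ coeff X (-n) ≠ 0 := by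
  obtain ⟨⟨ε, hε, hF⟩, hB, hBp, hB0, hX⟩ := h.data hs
  rw [coeff_mem_lamSym_iff hs h]
  refine and_congr_right fun hn => ?_
  constructor
  · intro hm h0
    cases n with
    -- No smaller m exists here, so X₀ ≠ 0 has to be proved: X₀ = F₀B₀ with B₀ invertible, and F₀ =
    -- 0 would make the constant loop F vanish.
    | zero =>
      have hF0 := (coeff_mem_lamSym_iff hs h 0).2 hn
      have hb := coeff_bottom hs h hF0
      have h1 : coeff F 0 = 0 := by
        have h2 : (0 : M2) = coeff F 0 * coeff B 0 := by
          rw [h0] at hb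
          simpa using hb
        calc coeff F 0 = coeff F 0 * coeff B 0 * (coeff B 0).adjugate := by
              rw [mul_assoc, mul_adjugate_of_det (det_coeff_zero hs hB hBp), mul_one]
          _ = 0 := by rw [← h2, zero_mul]
      have h3 : coeff F = 0 := by
        funext k
        by_cases hk : k = 0
        · rw [hk, h1]
          rfl
        · refine mem_lamSym.1 hF0 k ?_
          push_cast
          omega
      have h4 : F = fun _ => 0 := by
        refine coeff_ext hs hF.1.1 (isHs_const s 0) (h3.trans (funext fun k => ?_))
        rw [coeff_const]
        split_ifs <;> rfl
      have h5 := hF.1.2 1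
      rw [h4] at h5
      simp at h5
    | succ n =>
      refine hm n n.lt_succ_self ((coeff_mem_lamSym_iff hs h n).2 (mem_lamGE.2 fun j hj => ?_))
      rcases eq_or_ne j (-((n + 1 : ℕ) : ℤ)) with hj' | hj'
      · rw [hj', h0]
      · refine mem_lamGE.1 hn j ?_
        push_cast at hj' ⊢
        omega
  · intro h0 m hm hFm
    exact h0 (mem_lamGE.1 ((coeff_mem_lamSym_iff hs h m).1 hFm) _ (by omega))

/-! ### The algebraic system -/

theorem inv_mem_lambdaG_iff {s : ℝ} (hs : 1 / 2 < s) {L : Loop} (hL : IsHs s L) :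
    L⁻¹ ∈ LambdaG s ↔ (∀ z, (L z).det = 1) ∧
      (rhoLoop L = adjLoop L ∨ rhoLoop L = -adjLoop L) := by
  have hsig : ∀ M : Loop, M ∈ LambdaGC s → (M ∈ LambdaG s ↔
      (rhoLoop M = adjLoop M ∨ rhoLoop M = -adjLoop M)) := by
    intro M hM
    rw [mem_lambdaG_iff hs]
    refine or_congr ?_ ?_
    · rw [funext_iff]
      refine (and_iff_right hM).trans (forall_congr' fun z => ?_)
      rw [one_smul]
      rfl
    · rw [funext_iff]
      refine (and_iff_right hM).trans (forall_congr' fun z => ?_)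
      rw [neg_one_smul]
      rfl
  have hadj : adjLoop (adjLoop L) = L := funext fun z => adjugate_adjugate_two (L z)
  constructor
  · intro h
    have hdet : ∀ z, (L z).det = 1 := by
      intro z
      have h1 := h.1.2 z
      -- A singular L z would give an inverse of determinant 0, so the determinant of the formal
      -- inverse already decides that of L z.
      rwa [Pi.inv_apply, Matrix.det_nonsing_inv, Ring.inverse_eq_inv', inv_eq_one] at h1
    rw [inv_eq_adjLoop hdet] at h
    obtain ⟨ε, hε, hM⟩ := (mem_lambdaG_iff_exists hs).1 h
    have h2 := SignedG.adj hε hM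
    rw [hadj] at h2
    exact ⟨hdet, (hsig L h2.1).1 ((mem_lambdaG_iff_exists hs).2 ⟨ε, hε, h2⟩)⟩
  · rintro ⟨hdet, h⟩
    obtain ⟨ε, hε, hM⟩ := (mem_lambdaG_iff_exists hs).1 ((hsig L ⟨hL, hdet⟩).2 h)
    rw [inv_eq_adjLoop hdet]
    exact (mem_lambdaG_iff_exists hs).2 ⟨ε, hε, SignedG.adj hε hM⟩

/-- The determinant is a diagonal entry of L · adj L, so its coefficients are given by a
convolution; they vanish by themselves for |m| > 2n. -/
theorem det_laurentLoop_iff {n : ℕ} {W : ℤ → M2} (hW : W ∈ LamSym n) {s : ℝ} (hs : 1 / 2 < s) :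
    (∀ z, (laurentLoop n W z).det = 1) ↔ ∀ m ∈ Finset.Icc (-(2 * n : ℤ)) (2 * n),
      ∑ j ∈ Finset.Icc (-(n : ℤ)) n, (W j 0 0 * W (m - j) 1 1 - W j 0 1 * W (m - j) 1 0)
        = if m = 0 then 1 else 0 := by
  obtain ⟨hL, hLW⟩ := laurentLoop_eq hW s
  set L := laurentLoop n W
  have hadj := adjLoop_eq hL
  have hprod := hL.mul hs hadj.1
  have hcoeff : coeff (L * adjLoop L) = conv W (adj W) := by
    rw [coeff_mul hs hL hadj.1, hadj.2, hLW]
  have hdetfc : ∀ m, fc (fun z => (L z).det) m =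
      ∑ j ∈ Finset.Icc (-(n : ℤ)) n, (W j 0 0 * W (m - j) 1 1 - W j 0 1 * W (m - j) 1 0) := by
    intro m
    have h1 : (fun z => (L z).det) = fun z => (L * adjLoop L) z 0 0 := by
      funext z
      simp [adjLoop, Matrix.mul_adjugate]
    rw [h1, ← coeff_apply, hcoeff, conv_eq_sum hW, Matrix.sum_apply]
    refine Finset.sum_congr rfl fun j _ => ?_
    rw [Matrix.mul_apply, Fin.sum_univ_two, adj, Matrix.adjugate_fin_two]
    simp [sub_eq_add_neg]
  have hmem : MemHs s fun z => (L z).det := by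
    have h1 : (fun z => (L z).det) = fun z => (L * adjLoop L) z 0 0 := by
      funext z
      simp [adjLoop, Matrix.mul_adjugate]
    rw [h1]
    exact isHs_iff.1 hprod 0 0
  constructor
  · intro h m _
    rw [← hdetfc, ← fc_one]
    congr 1
    exact funext h
  · intro h
    have h2 : (fun z => (L z).det) = fun _ => 1 := by
      refine fc_ext hmem.1 continuous_const (hmem.summable hs) fun m => ?_
      rw [fc_one, hdetfc]
      by_cases hm : m ∈ Finset.Icc (-(2 * n : ℤ)) (2 * n)
      · exact h m hm
      · rw [Finset.mem_Icc] at hm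
        rw [if_neg (by omega)]
        refine Finset.sum_eq_zero fun j hj => ?_
        rw [Finset.mem_Icc] at hj
        rw [mem_lamSym.1 hW (m - j) (by omega)]
        simp
    exact fun z => congrFun h2 z

theorem rhoLoop_laurentLoop_iff {n : ℕ} {W : ℤ → M2} (hW : W ∈ LamSym n) {s : ℝ}
    (hs : 1 / 2 < s) :
    (rhoLoop (laurentLoop n W) = adjLoop (laurentLoop n W) ↔
      ∀ j ∈ Finset.Icc (-(n : ℤ)) n, sigma3 * (W (-j))ᴴ * sigma3 = (W j).adjugate) ∧
    (rhoLoop (laurentLoop n W) = -adjLoop (laurentLoop n W) ↔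
      ∀ j ∈ Finset.Icc (-(n : ℤ)) n, sigma3 * (W (-j))ᴴ * sigma3 = -(W j).adjugate) := by
  obtain ⟨hL, hLW⟩ := laurentLoop_eq hW s
  set L := laurentLoop n W
  have hadj := adjLoop_eq hL
  have hrho := rhoLoop_eq hs hL
  rw [hLW] at hadj hrho
  have hneg : -adjLoop L = (-1 : ℂ) • adjLoop L := (neg_one_smul ℂ _).symm
  have hout : ∀ j, j ∉ Finset.Icc (-(n : ℤ)) n → rhoMat (W (-j)) = 0 ∧ (W j).adjugate = 0 := by
    intro j hj
    rw [Finset.mem_Icc] at hj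
    rw [mem_lamSym.1 hW j (by omega), mem_lamSym.1 hW (-j) (by omega)]
    exact ⟨rhoMat_zero, adjugate_zero_two⟩
  constructor
  · constructor
    · intro h j _
      have := hrho.2
      rw [h, hadj.2] at this
      exact (congrFun this j).symm
    · intro h
      refine coeff_ext hs hrho.1 hadj.1 ?_
      rw [hrho.2, hadj.2]
      funext j
      by_cases hj : j ∈ Finset.Icc (-(n : ℤ)) n
      · exact h j hj
      · rw [rho_apply, adj, (hout j hj).1, (hout j hj).2]
  · rw [hneg]
    constructor
    · intro h j _
      have := hrho.2
      rw [h, coeff_smul, hadj.2, neg_one_smul] at this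
      exact (congrFun this j).symm
    · intro h
      refine coeff_ext hs hrho.1 (hadj.1.smul _) ?_
      rw [hrho.2, coeff_smul, hadj.2, neg_one_smul]
      funext j
      by_cases hj : j ∈ Finset.Icc (-(n : ℤ)) n
      · exact h j hj
      · rw [Pi.neg_apply, rho_apply, adj, (hout j hj).1, (hout j hj).2, neg_zero]

/-- W and X both start at degree -n, so WX starts at -2n and finitely many equations express that it
is plus. -/
theorem algebraicSystem_iff {s : ℝ} (hs : 1 / 2 < s) {n : ℕ} {X : Loop} (hX : X ∈ LambdaGC s)
    (hXn : coeff X ∈ LamGE n) {W : ℤ → M2} (hW : W ∈ LamSym n) :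
    ((laurentLoop n W)⁻¹ ∈ LambdaG s ∧ laurentLoop n W * X ∈ LambdaPlusReal s) ↔
      AlgebraicSystem n (coeff X) W := by
  have hdet := det_laurentLoop_iff hW hs
  obtain ⟨hr1, hr2⟩ := rhoLoop_laurentLoop_iff hW hs
  obtain ⟨hL, hLW⟩ := laurentLoop_eq hW s
  have hcoeff : coeff (laurentLoop n W * X) = conv W (coeff X) := by
    rw [coeff_mul hs hL hX.1, hLW]
  have hplus : Plus (laurentLoop n W * X) ↔ ∀ k ∈ Finset.Icc (-(2 * n : ℤ)) (-1),
      ∑ j ∈ Finset.Icc (-(n : ℤ)) n, W j * coeff X (k - j) = 0 := by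
    unfold Plus
    simp only [hcoeff, ← conv_eq_sum hW]
    constructor
    · intro h k hk
      rw [Finset.mem_Icc] at hk
      exact h k (by omega)
    · intro h k hk
      by_cases hk2 : -(2 * n : ℤ) ≤ k
      · exact h k (Finset.mem_Icc.2 ⟨hk2, by omega⟩)
      · exact (conv_of_ge (fun j hj => mem_lamSym.1 hW j (Or.inl hj)) (mem_lamGE.1 hXn)).1 k
          (by omega)
  have hzero : coeff (laurentLoop n W * X) 0 =
      ∑ j ∈ Finset.Icc (-(n : ℤ)) n, W j * coeff X (-j) := by
    rw [hcoeff, conv_eq_sum hW]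
    simp only [zero_sub]
  rw [inv_mem_lambdaG_iff hs hL, mem_lambdaPlusReal_iff hs, AlgebraicSystem, ← hdet, ← hr1, ← hr2,
    ← hplus, ← hzero]
  constructor
  · rintro ⟨⟨h1, h2⟩, -, h3, h4⟩
    exact ⟨h1, h2, h3, h4⟩
  · rintro ⟨h1, h2, h3, h4⟩
    exact ⟨⟨h1, h2⟩, LambdaGC.mul hs ⟨hL, h1⟩ hX, h3, h4⟩

/-! ### The inverse factor as the unique solution of the system -/

theorem IsNormalizedIwasawa.laurentLoop_inv {s : ℝ} (hs : 1 / 2 < s) {n : ℕ} {X F B : Loop}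
    (h : IsNormalizedIwasawa s X F B) (hXn : coeff X ∈ LamGE n) :
    coeff F⁻¹ ∈ LamSym n ∧ laurentLoop n (coeff F⁻¹) = F⁻¹ := by
  have hF := h.1.1
  have hinv := inv_eq_adjLoop hF.2
  have hs1 := adjLoop_eq hF.1
  have hmem : coeff F⁻¹ ∈ LamSym n := by
    rw [hinv, hs1.2]
    exact adj_mem_lamSym ((coeff_mem_lamSym_iff hs h n).2 hXn)
  obtain ⟨h1, h2⟩ := laurentLoop_eq hmem s
  exact ⟨hmem, coeff_ext hs h1 (hinv ▸ hs1.1) h2⟩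

theorem IsNormalizedIwasawa.algebraicSystem {s : ℝ} (hs : 1 / 2 < s) {n : ℕ} {X F B : Loop}
    (h : IsNormalizedIwasawa s X F B) (hXn : coeff X ∈ LamGE n) :
    AlgebraicSystem n (coeff X) (coeff F⁻¹) := by
  obtain ⟨-, -, -, -, hX⟩ := h.data hs
  obtain ⟨hmem, hloop⟩ := h.laurentLoop_inv hs hXn
  refine (algebraicSystem_iff hs hX hXn hmem).1 ?_
  have hF := h.1.1
  rw [hloop]
  constructor
  · have : (F⁻¹)⁻¹ = F := funext fun z => Matrix.nonsing_inv_nonsing_inv _ (by simp [hF.2 z])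
    rw [this]
    exact h.1
  · rw [h.2.2, inv_eq_adjLoop hF.2, ← mul_assoc, adjLoop_mul_self hF.2, one_mul]
    exact h.2.1

/-- A solution W yields the normalized factorization X = W⁻¹ · (WX), to which uniqueness applies. -/
theorem IsNormalizedIwasawa.eq_of_algebraicSystem {s : ℝ} (hs : 1 / 2 < s) {n : ℕ}
    {X F B : Loop} (h : IsNormalizedIwasawa s X F B) (hXn : coeff X ∈ LamGE n) {W : ℤ → M2}
    (hW : W ∈ LamSym n) (hA : AlgebraicSystem n (coeff X) W) : W = coeff F⁻¹ := by
  obtain ⟨-, -, -, -, hX⟩ := h.data hs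
  obtain ⟨hL, hLW⟩ := laurentLoop_eq hW s
  obtain ⟨h1, h2⟩ := (algebraicSystem_iff hs hX hXn hW).2 hA
  have hdet := ((inv_mem_lambdaG_iff hs hL).1 h1).1
  have h3 : IsNormalizedIwasawa s X (laurentLoop n W)⁻¹ (laurentLoop n W * X) := by
    refine ⟨h1, h2, ?_⟩
    rw [inv_eq_adjLoop hdet, ← mul_assoc, adjLoop_mul_self hdet, one_mul]
  have h4 := (h.unique hs h3).1
  have h5 : F⁻¹ = laurentLoop n W := by
    rw [h4]
    exact funext fun z => Matrix.nonsing_inv_nonsing_inv _ (by simp [hdet z])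
  rw [h5, hLW]

/-! ### The two kernels -/

theorem mul_sigma3_inv {g : M2} (h : g.det = 1) : (g * sigma3)⁻¹ = sigma3 * g.adjugate := by
  refine Matrix.inv_eq_right_inv ?_
  rw [mul_assoc, ← mul_assoc sigma3, sigma3_mul_self, one_mul, mul_adjugate_of_det h]

theorem diag_one (c : ℂ) : (!![c, 0; 0, 1 * c] : M2) = c • 1 := by
  rw [Matrix.one_fin_two]
  simp

theorem diag_neg_one (c : ℂ) : (!![c, 0; 0, -1 * c] : M2) = c • sigma3 := by
  rw [sigma3]
  simp

theorem iwasawaMap_eq_zero_iff_inv {s : ℝ} (hs : 1 / 2 < s) {X F B : Loop}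
    (h : IsNormalizedIwasawa s X F B) (hF : F ∈ LambdaGTau s) {W : Loop} (hW : IsHs s W) :
    iwasawaMap (coeff X) (coeff W) = 0 ↔ ∃ c : ℂ, W = c • F⁻¹ := by
  rw [mem_lambdaGTau_iff] at hF
  rw [iwasawaMap_coeff_eq_zero_iff hs h (Or.inl rfl) hF hW, inv_eq_adjLoop hF.1.2]
  refine exists_congr fun c => ?_
  rw [diag_one]
  simp only [Matrix.smul_mul, one_mul]
  rfl

theorem iwasawaMap_eq_zero_iff_sigma3_inv {s : ℝ} (hs : 1 / 2 < s) {X F B : Loop}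
    (h : IsNormalizedIwasawa s X F B) (hF : F ∈ sigma1LambdaGTau s) {W : Loop}
    (hW : IsHs s W) : iwasawaMap (coeff X) (coeff W) = 0 ↔
      ∃ c : ℂ, W = c • (fun z => (F z * sigma3)⁻¹) := by
  rw [mem_sigma1LambdaGTau_iff hs] at hF
  rw [iwasawaMap_coeff_eq_zero_iff hs h (Or.inr rfl) hF hW]
  refine exists_congr fun c => ?_
  simp only [diag_neg_one, Matrix.smul_mul, mul_sigma3_inv (hF.1.2 _)]
  rfl

theorem sigma3_mul_inv_laurent {s : ℝ} (hs : 1 / 2 < s) {n : ℕ} {X F B : Loop}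
    (h : IsNormalizedIwasawa s X F B) (hXn : coeff X ∈ LamGE n) :
    IsHs s (fun z => (F z * sigma3)⁻¹) ∧ coeff (fun z => (F z * sigma3)⁻¹) ∈ LamSym n := by
  have hF := h.1.1
  have e : (fun z => (F z * sigma3)⁻¹) = (fun _ => sigma3) * adjLoop F :=
    funext fun z => mul_sigma3_inv (hF.2 z)
  have hs1 := adjLoop_eq hF.1
  have hmem := adj_mem_lamSym ((coeff_mem_lamSym_iff hs h n).2 hXn)
  rw [← hs1.2, mem_lamSym] at hmem
  rw [e]
  refine ⟨(isHs_const s _).mul hs hs1.1, ?_⟩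
  have hc : coeff (fun _ => sigma3) ∈ LamSym 0 := mem_lamSym.2 fun j hj => by
    rw [coeff_const, if_neg (by push_cast at hj; omega)]
  refine mem_lamSym.2 fun j hj => ?_
  rw [coeff_mul hs (isHs_const s _) hs1.1, conv_eq_sum hc]
  simp [hmem j hj]

theorem I_sigma3_pow_two : (I • sigma3) ^ 2 = (-1 : M2) := by
  rw [pow_two, Matrix.smul_mul, Matrix.mul_smul, sigma3_mul_self, smul_smul, I_mul_I,
    neg_one_smul]

/-- Recovering `F` from a nonzero multiple of `F⁻¹`. -/
theorem recover_of_smul_inv {F : Loop} (hF : ∀ z, (F z).det = 1) {L : Loop} {c₀ : ℂ}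
    (hL : L = c₀ • F⁻¹) (hc₀ : c₀ ≠ 0) : ∃ d : ℂ, d ≠ 0 ∧ (∀ z, (L z).det = d) ∧
      ∀ c : ℂ, c ^ 2 * d = 1 → ∃ k : ℕ, k ≤ 3 ∧
        F = fun z => ((I • sigma3) ^ k * (c • L z))⁻¹ := by
  have hLz : ∀ z, L z = c₀ • (F z).adjugate := fun z => by
    rw [hL, Pi.smul_apply, Pi.inv_apply, inv_of_det (hF z)]
  refine ⟨c₀ ^ 2, pow_ne_zero 2 hc₀, fun z => ?_, fun c hc => ?_⟩
  · rw [hLz, Matrix.det_smul, det_adjugate_two, hF, mul_one]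
    rfl
  -- Thus cL = ±F⁻¹; the sign is corrected by k = 0 or by k = 2, since (iσ₃)² = -1.
  · have h1 : (c * c₀) ^ 2 = 1 := by rw [mul_pow, hc]
    rcases sq_eq_one_iff.1 h1 with h | h
    · refine ⟨0, by norm_num, funext fun z => (Matrix.inv_eq_right_inv ?_).symm⟩
      rw [pow_zero, one_mul, hLz, smul_smul, h, one_smul, adjugate_mul_of_det (hF z)]
    · refine ⟨2, by norm_num, funext fun z => (Matrix.inv_eq_right_inv ?_).symm⟩
      rw [I_sigma3_pow_two, hLz, smul_smul, h, neg_one_smul, neg_mul_neg, one_mul,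
        adjugate_mul_of_det (hF z)]

/-- Recovering `F` from a nonzero multiple of `(F σ₃)⁻¹`. -/
theorem recover_of_smul_sigma3_inv {F : Loop} (hF : ∀ z, (F z).det = 1) {L : Loop} {c₀ : ℂ}
    (hL : L = c₀ • (fun z => (F z * sigma3)⁻¹)) (hc₀ : c₀ ≠ 0) :
    ∃ d : ℂ, d ≠ 0 ∧ (∀ z, (L z).det = d) ∧
      ∀ c : ℂ, c ^ 2 * d = 1 → ∃ k : ℕ, k ≤ 3 ∧
        F = fun z => ((I • sigma3) ^ k * (c • L z))⁻¹ := by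
  have hLz : ∀ z, L z = c₀ • (sigma3 * (F z).adjugate) := fun z => by
    rw [hL, Pi.smul_apply, mul_sigma3_inv (hF z)]
  have hσ : ∀ (e : ℂ) (z : Circle),
      (I • sigma3) * (e • (sigma3 * (F z).adjugate)) * F z = (I * e) • 1 := by
    intro e z
    rw [Matrix.smul_mul, Matrix.mul_smul, smul_smul, ← mul_assoc, sigma3_mul_self, one_mul,
      Matrix.smul_mul, adjugate_mul_of_det (hF z)]
  refine ⟨-c₀ ^ 2, neg_ne_zero.2 (pow_ne_zero 2 hc₀), fun z => ?_, fun c hc => ?_⟩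
  · rw [hLz, Matrix.det_smul, Matrix.det_mul, det_sigma3, det_adjugate_two, hF, mul_one,
      mul_neg_one]
    rfl
  -- As det σ₃ = -1, now cc₀ = ±i and cL = ±iσ₃F⁻¹. Since iσ₃ has fourth power 1, k = 3 undoes the
  -- plus sign and k = 1 the minus sign.
  · have h1 : (c * c₀) ^ 2 = I ^ 2 := by
      rw [I_sq]
      linear_combination -hc
    rcases sq_eq_sq_iff_eq_or_eq_neg.1 h1 with h | h
    · refine ⟨3, le_rfl, funext fun z => (Matrix.inv_eq_right_inv ?_).symm⟩
      rw [pow_succ, I_sigma3_pow_two, hLz, smul_smul, h, mul_assoc, mul_assoc, ← mul_assoc (I • sigma3),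
        hσ, I_mul_I, neg_one_smul, neg_mul_neg, one_mul]
    · refine ⟨1, by norm_num, funext fun z => (Matrix.inv_eq_right_inv ?_).symm⟩
      rw [pow_one, hLz, smul_smul, h, hσ, mul_neg, I_mul_I, neg_neg, one_smul]

theorem recover_of_mem_ker {s : ℝ} {n : ℕ} {X F K : Loop}
    (hK : ∀ W : Loop, IsHs s W → (iwasawaMap (coeff X) (coeff W) = 0 ↔ ∃ c : ℂ, W = c • K))
    (hrec : ∀ (L : Loop) (c₀ : ℂ), L = c₀ • K → c₀ ≠ 0 →
      ∃ d : ℂ, d ≠ 0 ∧ (∀ z, (L z).det = d) ∧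
        ∀ c : ℂ, c ^ 2 * d = 1 → ∃ k : ℕ, k ≤ 3 ∧
          F = fun z => ((I • sigma3) ^ k * (c • L z))⁻¹)
    (W : LamSym n) (hW : W ∈ LinearMap.ker (iwasawaLin n (coeff X))) (hW0 : W ≠ 0) :
    ∃ d : ℂ, d ≠ 0 ∧ (∀ z, (laurentLoop n W z).det = d) ∧
      ∀ c : ℂ, c ^ 2 * d = 1 → ∃ k : ℕ, k ≤ 3 ∧
        F = fun z => ((I • sigma3) ^ k * (c • laurentLoop n W z))⁻¹ := by
  obtain ⟨h1, h2⟩ := laurentLoop_eq W.2 s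
  obtain ⟨c₀, hc₀⟩ := (hK _ h1).1 (by rw [h2]; exact hW)
  refine hrec _ c₀ hc₀ fun h0 => hW0 (Subtype.ext ?_)
  rw [← h2, hc₀, h0, coeff_smul, zero_smul]
  rfl

end LoopIwasawa

end

/-! ### Assembly of the theorem -/

open LoopIwasawa in
theorem theorem1p5 (s : ℝ) (hs : 1 / 2 < s) (n : ℕ) (X : Loop) (hX : X ∈ iwasawaBigCell s) :
    (coeff X ∈ LamGE n →
      -- the normalized factorization exists and is unique
      (∃! FB : Loop × Loop, IsNormalizedIwasawa s X FB.1 FB.2) ∧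
      -- the linear system: `8n + 4` unknowns, `16n + 4` equations
      Module.finrank ℂ (LamSym n) = 8 * n + 4 ∧
      Module.finrank ℂ (targetSpace n) = 16 * n + 4 ∧
      LinearMap.range (iwasawaLin n (coeff X)) ≤ targetSpace n ∧
      ∀ F B : Loop, IsNormalizedIwasawa s X F B →
        -- the kernel is one of two explicit lines
        (F ∈ LambdaGTau s ∨ F ∈ sigma1LambdaGTau s) ∧
        (F ∈ LambdaGTau s →
          ((LinearMap.ker (iwasawaLin n (coeff X))).map (LamSym n).subtype
              = Submodule.span ℂ {coeff F⁻¹}) ∧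
          ∀ W : Loop, IsHs s W →
            (iwasawaMap (coeff X) (coeff W) = 0 ↔ ∃ c : ℂ, W = c • F⁻¹)) ∧
        (F ∈ sigma1LambdaGTau s →
          ((LinearMap.ker (iwasawaLin n (coeff X))).map (LamSym n).subtype
              = Submodule.span ℂ {coeff (fun z => (F z * sigma3)⁻¹)}) ∧
          ∀ W : Loop, IsHs s W →
            (iwasawaMap (coeff X) (coeff W) = 0 ↔
              ∃ c : ℂ, W = c • (fun z => (F z * sigma3)⁻¹))) ∧
        -- recovering `F` from any nonzero element of the kernel
        (∀ W ∈ LinearMap.ker (iwasawaLin n (coeff X)), W ≠ 0 →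
          ∃ d : ℂ, d ≠ 0 ∧ (∀ z, (laurentLoop n W z).det = d) ∧
            ∀ c : ℂ, c ^ 2 * d = 1 → ∃ k : ℕ, k ≤ 3 ∧
              F = fun z => ((Complex.I • sigma3) ^ k * (c • laurentLoop n W z))⁻¹) ∧
        -- the conditions on `F` and `B` as an algebraic system with a unique solution
        (∀ W ∈ LamSym n,
          ((laurentLoop n W)⁻¹ ∈ LambdaG s ∧ laurentLoop n W * X ∈ LambdaPlusReal s) ↔
            AlgebraicSystem n (coeff X) W) ∧
        (∃! W : ℤ → M2, W ∈ LamSym n ∧ AlgebraicSystem n (coeff X) W) ∧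
        coeff F⁻¹ ∈ LamSym n ∧ AlgebraicSystem n (coeff X) (coeff F⁻¹)) ∧
    -- without assuming that `X` is a Laurent loop
    ∀ F B : Loop, IsNormalizedIwasawa s X F B →
      (coeff F ∈ LamSym n ↔ ExtendsWithPoleLE X n) ∧
      ((coeff F ∈ LamSym n ∧ ∀ m < n, coeff F ∉ LamSym m) ↔ ExtendsWithPole X n) := by
  refine ⟨fun hXn => ?_, fun F B h => ?_⟩
  · obtain ⟨F₀, B₀, h₀⟩ := exists_isNormalizedIwasawa hs hX
    refine ⟨⟨(F₀, B₀), h₀, fun FB h => Prod.ext (h.unique hs h₀).1 (h.unique hs h₀).2⟩,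
      finrank_lamSym n, finrank_targetSpace n, range_iwasawaLin_le hXn, fun F B h => ?_⟩
    have hdet := h.1.1.2
    obtain ⟨hmem, hloop⟩ := h.laurentLoop_inv hs hXn
    have hinv : IsHs s F⁻¹ := hloop ▸ (laurentLoop_eq hmem s).1
    obtain ⟨hσ, hσmem⟩ := sigma3_mul_inv_laurent hs h hXn
    have hcases : F ∈ LambdaGTau s ∨ F ∈ sigma1LambdaGTau s := by
      rw [mem_lambdaGTau_iff, mem_sigma1LambdaGTau_iff hs]
      exact (mem_lambdaG_iff hs).1 h.1
    refine ⟨hcases, fun hF => ?_, fun hF => ?_, fun W hW hW0 => ?_,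
      fun W hW => algebraicSystem_iff hs hX.1 hXn hW,
      ⟨coeff F⁻¹, ⟨hmem, h.algebraicSystem hs hXn⟩,
        fun W hW => h.eq_of_algebraicSystem hs hXn hW.1 hW.2⟩,
      hmem, h.algebraicSystem hs hXn⟩
    · have hker := fun W (hW : IsHs s W) => iwasawaMap_eq_zero_iff_inv hs h hF hW
      exact ⟨map_ker_eq_span hinv hmem hker, hker⟩
    · have hker := fun W (hW : IsHs s W) => iwasawaMap_eq_zero_iff_sigma3_inv hs h hF hW
      exact ⟨map_ker_eq_span hσ hσmem hker, hker⟩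
    · rcases hcases with hF | hF
      · exact recover_of_mem_ker (fun V hV => iwasawaMap_eq_zero_iff_inv hs h hF hV)
          (fun _ _ h1 h2 => recover_of_smul_inv hdet h1 h2) W hW hW0
      · exact recover_of_mem_ker (fun V hV => iwasawaMap_eq_zero_iff_sigma3_inv hs h hF hV)
          (fun _ _ h1 h2 => recover_of_smul_sigma3_inv hdet h1 h2) W hW hW0
  · have hXs : IsHs s X := hX.1.1
    exact ⟨(coeff_mem_lamSym_iff hs h n).trans (extendsWithPoleLE_iff hs hXs n).symm,
      (minimal_degree_iff hs h n).trans (extendsWithPole_iff hs hXs n).symm⟩
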